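/- **Theorem 1.** Let $k\ge 1$ be an integer. A *rooted $k$-tree* is a simple graph which is either a $k$-clique (the root clique) or arises from a rooted $k$-tree by adding a new node $u$ joined to exactly the nodes of one of its $k$-cliques $K$; then $u$ is called a child of $K$ and the nodes of $K$ are called the parents of $u$. An *ordered increasing $k$-tree of size $n$* is a rooted $k$-tree with root nodes $0_1,\dots,0_k$ (whose labels count as $0$) and non-root nodes labelled $1,\dots,n$ such that the label of each non-root node is larger than the labels of its parents, together with a linear order on the set of children of each $k$-clique. Choose one of the finitely many ordered increasing $k$-trees of size $n$ uniformly at random, and for $1\le j\le n$ let $Y_{n,j}$ be the out-degree of node $j$, i.e. the number of nodes that have $j$ as a parent. With generalized binomial coefficients $\binom{x}{r}=x(x-1)\cdots(x-r+1)/r!$, $Y_{n,j}$ has the exact distribution $$\mathbb{P}\{Y_{n,j}=m\}=\frac{\binom{j-\frac{k}{k+1}}{j}}{\binom{n-\frac{k}{k+1}}{n}\binom{n}{j}}\sum_{\ell=0}^{m}\binom{m}{\ell}(-1)^{\ell}\binom{n-\frac{k(2+\ell)}{k+1}}{n-j},\qquad n\ge j\ge 1,\ m\ge 0.$$ The limiting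 behaviour of $Y_{n,j}$, for $n\to\infty$ and depending on the growth of $j=j(n)$, is as follows. * *$j\ge 1$ fixed.* $n^{-\frac{k}{k+1}}Y_{n,j}$ converges in distribution to a random variable $Y_j$ whose law is uniquely determined by its moments; all of these are finite and, for integers $s\ge 0$, $$\mathbb{E}(Y_j^s)=\frac{s!\,\Gamma\!\left(j+\frac{1}{k+1}\right)}{\Gamma\!\left(j+1+\frac{k(s-1)}{k+1}\right)}.$$ * *$j\to\infty$ with $j=o(n)$.* $\left(\frac{j}{n}\right)^{\frac{k}{k+1}}Y_{n,j}$ converges in distribution to a random variable $Y$ that is exponentially distributed with parameter $1$, so that $\mathbb{E}(Y^s)=s!$ for integers $s\ge 0$. * *$j\to\infty$ with $j\sim\rho n$, $0<\rho<1$.* $Y_{n,j}$ converges in distribution to a geometrically distributed random variable $Y_\rho$ with success probability $\rho^{\frac{k}{k+1}}$, i.e. $\mathbb{P}\{Y_\rho=m\}=\rho^{\frac{k}{k+1}}\left(1-\rho^{\frac{k}{k+1}}\right)^m$ for integers $m\ge 0$. * *$j\to\infty$ with $j\le n$ and $n-j=o(n)$.* $\mathbb{P}\{Y_{n,j}=0\}\to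 1$. -/

import Mathlib

open Filter Topology MeasureTheory ProbabilityTheory Asymptotics

/-- Nodes of a labelled `k`-tree of size `n`: the `k` root nodes `0_1, …, 0_k` (left summand), and
the `n` inserted (non-root) nodes `1, …, n` (right summand; `Sum.inr i` is the node labelled
`i + 1`). -/
abbrev KTreeNode (k n : ℕ) : Type := Fin k ⊕ Fin n

/-- The numerical label of a node: root nodes count as `0`, the inserted nodes carry the labels
`1, …, n`. -/
def KTreeNode.label {k n : ℕ} : KTreeNode k n → ℕ
  | Sum.inl _ => 0
  | Sum.inr i => (i : ℕ) + 1

/-- The set of root nodes. -/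
def rootNodes (k n : ℕ) : Finset (KTreeNode k n) :=
  Finset.univ.map Function.Embedding.inl

/-- `IsRootedKTree G par s`: the subgraph of `G` induced on `s` is a `k`-tree rooted at the clique
of root nodes, and `par v` is the set of parents (starting points of the ingoing edges) of each
non-root node `v` in `s`. Either `s` consists of the root clique only, or `s` arises from a rooted
`k`-tree by adding a node `u` whose neighbours in it are exactly the elements of some `k`-clique,
the parents of `u`. -/
inductive IsRootedKTree {k n : ℕ} (G : SimpleGraph (KTreeNode k n))
    (par : Fin n → Finset (KTreeNode k n)) : Finset (KTreeNode k n) → Prop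
  | root : G.IsNClique k (rootNodes k n) → IsRootedKTree G par (rootNodes k n)
  | attach (s : Finset (KTreeNode k n)) (u : Fin n) :
      IsRootedKTree G par s → Sum.inr u ∉ s →
      par u ⊆ s → G.IsNClique k (par u) →
      (∀ w ∈ s, G.Adj (Sum.inr u) w ↔ w ∈ par u) →
      IsRootedKTree G par (insert (Sum.inr u) s)

/-- Ordered increasing `k`-trees of size `n` (that is, with `n` non-root nodes). -/
structure OrderedIncreasingKTree (k n : ℕ) where
  /-- The underlying simple graph. -/
  graph : SimpleGraph (KTreeNode k n)
  /-- The parents of each non-root node. -/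
  parents : Fin n → Finset (KTreeNode k n)
  /-- The graph is a rooted `k`-tree, and `parents` is the orientation induced by the root. -/
  isRootedKTree : IsRootedKTree graph parents Finset.univ
  /-- The label of a node is larger than the labels of its parents. -/
  increasing : ∀ v : Fin n, ∀ w ∈ parents v,
    KTreeNode.label w < KTreeNode.label (Sum.inr v : KTreeNode k n)
  /-- The linear orders on the children of the `k`-cliques: `childLT u v` says that `u` and `v` are
  children of the same clique and that `u` comes before `v`. -/
  childLT : Fin n → Fin n → Prop
  childLT_siblings : ∀ u v, childLT u v → parents u = parents v
  childLT_irrefl : ∀ u, ¬ childLT u u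
  childLT_trans : ∀ u v w, childLT u v → childLT v w → childLT u w
  childLT_total : ∀ u v, parents u = parents v → u ≠ v → childLT u v ∨ childLT v u

namespace OrderedIncreasingKTree

instance instFinite (k n : ℕ) : Finite (OrderedIncreasingKTree k n) := by
  classical
  refine Finite.of_injective
    (β := SimpleGraph (KTreeNode k n) × (Fin n → Finset (KTreeNode k n)) × (Fin n → Fin n → Prop))
    (fun T => (T.graph, T.parents, T.childLT)) ?_
  rintro ⟨g, p, _, _, l, _, _, _, _⟩ ⟨g', p', _, _, l', _, _, _, _⟩ h
  simp only [Prod.mk.injEq] at h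
  obtain ⟨rfl, rfl, rfl⟩ := h
  rfl

/-- All nodes attached to the root clique. -/
instance instNonempty (k n : ℕ) : Nonempty (OrderedIncreasingKTree k n) := by
  classical
  let G : SimpleGraph (KTreeNode k n) :=
    { Adj := fun x y => x ≠ y ∧ (x ∈ rootNodes k n ∨ y ∈ rootNodes k n)
      symm := ⟨fun x y h => ⟨h.1.symm, h.2.symm⟩⟩
      loopless := ⟨fun x h => h.1 rfl⟩ }
  have hR : G.IsNClique k (rootNodes k n) := by
    refine ⟨?_, by simp [rootNodes]⟩
    intro x hx y _ hxy
    exact ⟨hxy, Or.inl hx⟩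
  have key : ∀ t : Finset (Fin n), IsRootedKTree G (fun _ => rootNodes k n)
      (rootNodes k n ∪ t.map Function.Embedding.inr) := by
    intro t
    induction t using Finset.induction_on with
    | empty => simpa using IsRootedKTree.root hR
    | insert u t hu ih =>
      have h := IsRootedKTree.attach (G := G) (par := fun _ => rootNodes k n) _ u ih
        (by simp [rootNodes, hu]) Finset.subset_union_left hR
        (by
          intro w hw
          have hur : (Sum.inr u : KTreeNode k n) ∉ rootNodes k n := by simp [rootNodes]
          constructor
          · rintro ⟨_, h | h⟩
            · exact absurd h hur
            · exact h
          · intro h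
            exact ⟨fun e => hur (e ▸ h), Or.inr h⟩)
      simpa [Finset.map_insert, Finset.union_insert] using h
  have huniv : rootNodes k n ∪ (Finset.univ : Finset (Fin n)).map Function.Embedding.inr
      = Finset.univ := by
    ext x
    rcases x with x | x <;> simp [rootNodes]
  exact ⟨{
    graph := G
    parents := fun _ => rootNodes k n
    isRootedKTree := huniv ▸ key Finset.univ
    increasing := by
      intro v w hw
      obtain ⟨i, -, rfl⟩ := Finset.mem_map.1 hw
      exact Nat.succ_pos _
    childLT := fun u v => u < v
    childLT_siblings := fun _ _ _ => rfl
    childLT_irrefl := fun u => lt_irrefl u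
    childLT_trans := fun _ _ _ => lt_trans
    childLT_total := fun _ _ _ h => lt_or_gt_of_ne h }⟩

instance instMeasurableSpace (k n : ℕ) : MeasurableSpace (OrderedIncreasingKTree k n) := ⊤

open Classical in
/-- The out-degree of the node labelled `j`, for `1 ≤ j`: the number of nodes that have it as a
parent. (It is `0` if there is no non-root node with label `j`.) -/
noncomputable def outDegree {k n : ℕ} (j : ℕ) (T : OrderedIncreasingKTree k n) : ℕ :=
  (Finset.univ.filter fun v : Fin n => ∃ u : Fin n,
    KTreeNode.label (Sum.inr u : KTreeNode k n) = j ∧ Sum.inr u ∈ T.parents v).card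

end OrderedIncreasingKTree

/-- The random ordered increasing `k`-tree model: every tree of size `n` is equally likely. -/
noncomputable def randomKTree (k n : ℕ) : Measure (OrderedIncreasingKTree k n) :=
  uniformOn Set.univ

instance randomKTree.instIsProbabilityMeasure (k n : ℕ) :
    IsProbabilityMeasure (randomKTree k n) :=
  isProbabilityMeasure_uniformOn Set.finite_univ Set.univ_nonempty

instance expMeasure_one.instIsProbabilityMeasure : IsProbabilityMeasure (expMeasure 1) :=
  isProbabilityMeasure_expMeasure one_pos

/-!
Let `a = k / (k + 1)`. An ordered increasing `k`-tree of size `n + 1` arises in exactly one way from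
one of size `n` by choosing a position for the new node: as the last child of one of the `1 + n k`
cliques, or immediately before one of the `n` inserted nodes among its siblings
(`OrderedIncreasingKTree.extend_injective`, `OrderedIncreasingKTree.extend_surjective`). Of these
`1 + n (k + 1)` positions, `k (d + 1)` make the new node a child of a given node of out-degree `d`:
such a node lies in `k + d (k - 1)` cliques and is a parent of `d` nodes. Hence the out-degree of
node `j` is a Markov chain that starts at `0` in size `j`, and moves from `d` to `d + 1` in the step
from size `n` to size `n + 1` with probability `a (d + 1) / (n + 1 - a)`
(`OrderedIncreasingKTree.integral_outDegree_succ`).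

This yields the point probabilities as alternating sums, and the rising factorial moments as single
products, of expressions `∏ (1 + c / (i + 1 - a))` over `j ≤ i < n`; the former is the exact
distribution. By Euler's limit formula for the Gamma function such a product behaves like a constant
times `n ^ c` for fixed `j`, and like `(n / j) ^ c` for `j → ∞`. If `j / n` has a positive limit,
the point probabilities therefore converge to those of a geometric law, which is a point mass at `0` if
the limit is `1`; this settles the last two regimes.

In the first two regimes, all moments of the scaled out-degree converge, to limits that grow at most
like factorials. The method of moments (`exists_tendsto_of_tendsto_moments`) then gives a limit law:
bounded second moments imply tightness, so cluster points exist by Prokhorov's theorem; each of them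
has the limiting moments; and moments of factorial growth determine a law, since they are the
Taylor coefficients of a moment generating function that is analytic in a strip around the
imaginary axis (`MeasureTheory.Measure.eq_of_moments`).
-/

/-! ### Nodes of trees of consecutive sizes -/

namespace KTreeNode

variable {k n : ℕ}

/-- The inclusion of the nodes of a `k`-tree of size `n` into those of a `k`-tree of size `n + 1`;
it preserves labels and misses exactly the node with the largest label. -/
def castSuccEmb (k n : ℕ) : KTreeNode k n ↪ KTreeNode k (n + 1) :=
  ⟨Sum.map id Fin.castSucc, Function.injective_id.sumMap (Fin.castSucc_injective n)⟩

@[simp] lemma castSuccEmb_inl (i : Fin k) :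
    castSuccEmb k n (Sum.inl i) = Sum.inl i := rfl

@[simp] lemma castSuccEmb_inr (u : Fin n) :
    castSuccEmb k n (Sum.inr u) = Sum.inr u.castSucc := rfl

lemma label_castSuccEmb (x : KTreeNode k n) : label (castSuccEmb k n x) = label x := by
  rcases x with i | u <;> simp [label]

@[simp] lemma label_inr (u : Fin n) : label (Sum.inr u : KTreeNode k n) = u + 1 := rfl

@[simp] lemma label_inl (i : Fin k) : label (Sum.inl i : KTreeNode k n) = 0 := rfl

lemma label_le (x : KTreeNode k n) : label x ≤ n := by
  rcases x with i | u
  · simp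
  · exact u.2

@[simp] lemma castSuccEmb_ne_last (x : KTreeNode k n) :
    castSuccEmb k n x ≠ Sum.inr (Fin.last n) := by
  intro h
  have h1 := congrArg label h
  have h2 := label_le x
  rw [label_castSuccEmb, label_inr, Fin.val_last] at h1
  omega

lemma exists_castSuccEmb_of_ne_last {x : KTreeNode k (n + 1)} (h : x ≠ Sum.inr (Fin.last n)) :
    ∃ y, castSuccEmb k n y = x := by
  rcases x with i | u
  · exact ⟨Sum.inl i, rfl⟩
  · induction u using Fin.lastCases with
    | last => exact absurd rfl h
    | cast u => exact ⟨Sum.inr u, rfl⟩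

lemma map_rootNodes : (rootNodes k n).map (castSuccEmb k n) = rootNodes k (n + 1) := by
  ext x
  simp [rootNodes]

lemma label_eq_zero_of_mem_rootNodes {x : KTreeNode k n} (h : x ∈ rootNodes k n) :
    label x = 0 := by
  obtain ⟨i, -, rfl⟩ := Finset.mem_map.1 h
  rfl

end KTreeNode

/-! ### Parents and adjacency -/

namespace OrderedIncreasingKTree

open KTreeNode

variable {k n : ℕ}

/-- In a rooted `k`-tree with increasing labels, the parent sets are cliques and the parents of a
node are its neighbours with smaller labels, in whatever order the nodes were attached. -/
lemma _root_.IsRootedKTree.isNClique_and_adj_iff {G : SimpleGraph (KTreeNode k n)}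
    {par : Fin n → Finset (KTreeNode k n)}
    (hinc : ∀ v, ∀ w ∈ par v, label w < label (Sum.inr v : KTreeNode k n))
    {s : Finset (KTreeNode k n)} (h : IsRootedKTree G par s) :
    G.IsNClique k (rootNodes k n) ∧ ∀ u, Sum.inr u ∈ s →
      par u ⊆ s ∧ G.IsNClique k (par u) ∧
        ∀ w ∈ s, label w < label (Sum.inr u : KTreeNode k n) →
          (G.Adj (Sum.inr u) w ↔ w ∈ par u) := by
  induction h with
  | root h => exact ⟨h, fun u hu => by simp [rootNodes] at hu⟩
  | attach s u hs hu hsub hcl hadj ih =>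
    refine ⟨ih.1, fun v hv => ?_⟩
    by_cases hvu : v = u
    · subst hvu
      refine ⟨hsub.trans (Finset.subset_insert _ _), hcl, fun w hw hlt => ?_⟩
      rcases Finset.mem_insert.1 hw with rfl | hw
      · exact absurd hlt (lt_irrefl _)
      · exact hadj w hw
    · have hvs : Sum.inr v ∈ s := by simpa [hvu] using hv
      obtain ⟨h1, h2, h3⟩ := ih.2 v hvs
      refine ⟨h1.trans (Finset.subset_insert _ _), h2, fun w hw hlt => ?_⟩
      rcases Finset.mem_insert.1 hw with rfl | hw
      · rw [G.adj_comm, hadj _ hvs]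
        exact ⟨fun h => absurd (hinc u _ h) hlt.asymm, fun h => absurd (h1 h) hu⟩
      · exact h3 w hw hlt

variable (T : OrderedIncreasingKTree k n)

lemma isNClique_rootNodes : T.graph.IsNClique k (rootNodes k n) :=
  (IsRootedKTree.isNClique_and_adj_iff T.increasing T.isRootedKTree).1

lemma isNClique_parents (u : Fin n) : T.graph.IsNClique k (T.parents u) :=
  ((IsRootedKTree.isNClique_and_adj_iff T.increasing T.isRootedKTree).2 u (Finset.mem_univ _)).2.1

lemma adj_iff_mem_parents {u : Fin n} {w : KTreeNode k n}
    (h : label w < label (Sum.inr u : KTreeNode k n)) :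
    T.graph.Adj (Sum.inr u) w ↔ w ∈ T.parents u :=
  ((IsRootedKTree.isNClique_and_adj_iff T.increasing T.isRootedKTree).2 u (Finset.mem_univ _)).2.2 w
    (Finset.mem_univ _) h

lemma inr_self_notMem_parents (u : Fin n) : Sum.inr u ∉ T.parents u :=
  fun h => lt_irrefl _ (T.increasing u _ h)

/-- A tree is determined by its parent sets and sibling orders: adjacency can be read off from the
parent sets. -/
lemma ext_of_parents {T T' : OrderedIncreasingKTree k n} (hp : T.parents = T'.parents)
    (hl : T.childLT = T'.childLT) : T = T' := by
  have key : ∀ (u : Fin n) (w : KTreeNode k n), label w < label (Sum.inr u : KTreeNode k n) →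
      (T.graph.Adj (Sum.inr u) w ↔ T'.graph.Adj (Sum.inr u) w) := fun u w h => by
    rw [T.adj_iff_mem_parents h, T'.adj_iff_mem_parents h, hp]
  have hg : T.graph = T'.graph := by
    ext x y
    rcases x with i | u <;> rcases y with j | v
    · have hi : Sum.inl i ∈ rootNodes k n := by simp [rootNodes]
      have hj : Sum.inl j ∈ rootNodes k n := by simp [rootNodes]
      by_cases h : i = j
      · subst h; simp
      · exact iff_of_true (T.isNClique_rootNodes.1 hi hj (by simpa using h))
          (T'.isNClique_rootNodes.1 hi hj (by simpa using h))
    · rw [T.graph.adj_comm, T'.graph.adj_comm]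
      exact key v _ (by simp)
    · exact key u _ (by simp)
    · rcases lt_trichotomy u v with h | h | h
      · rw [T.graph.adj_comm, T'.graph.adj_comm]
        exact key v _ (by simpa using h)
      · subst h; simp
      · exact key u _ (by simpa using h)
  cases T; cases T'
  simp only at hp hl hg
  subst hp hl hg
  rfl

/-! ### Counting cliques -/

open Classical in
/-- The `k`-cliques are the root clique and, for every inserted node `u`, the `k` sets that arise
from the parents of `u` by exchanging one of them for `u`: `u` is the node with the largest label
in such a clique. -/
lemma sum_isNClique {M : Type*} [AddCommMonoid M] (f : Finset (KTreeNode k n) → M) :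
    ∑ K with T.graph.IsNClique k K, f K =
      f (rootNodes k n) +
        ∑ u, ∑ x ∈ T.parents u, f (insert (Sum.inr u) ((T.parents u).erase x)) := by
  let g : (Σ _ : Fin n, KTreeNode k n) → Finset (KTreeNode k n) :=
    fun p => insert (Sum.inr p.1) ((T.parents p.1).erase p.2)
  have hset : (Finset.univ.filter fun K => T.graph.IsNClique k K) =
      insert (rootNodes k n) ((Finset.univ.sigma T.parents).image g) := by
    ext K
    simp only [Finset.mem_filter, Finset.mem_univ, true_and, Finset.mem_insert, Finset.mem_image,
      Finset.mem_sigma]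
    constructor
    · intro hK
      by_cases hsub : K ⊆ rootNodes k n
      · left
        exact Finset.eq_of_subset_of_card_le hsub
          (by rw [hK.card_eq, T.isNClique_rootNodes.card_eq])
      right
      have hne : (Finset.univ.filter fun u : Fin n => Sum.inr u ∈ K).Nonempty := by
        obtain ⟨x, hx, hxr⟩ := Finset.not_subset.1 hsub
        rcases x with i | u
        · exact absurd (by simp [rootNodes]) hxr
        · exact ⟨u, by simpa using hx⟩
      obtain ⟨u, hu, hmax⟩ := Finset.exists_max_image _ id hne
      have huK : Sum.inr u ∈ K := by simpa using hu
      have hsubp : K.erase (Sum.inr u) ⊆ T.parents u := by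
        intro w hw
        obtain ⟨hwu, hwK⟩ := Finset.mem_erase.1 hw
        refine (T.adj_iff_mem_parents ?_).1 (hK.1 huK hwK hwu.symm)
        rcases w with i | v
        · simp
        · have h1 : v ≤ u := hmax v (by simpa using hwK)
          have h2 : v ≠ u := fun h => hwu (by rw [h])
          simpa using lt_of_le_of_ne h1 h2
      have hc : (K.erase (Sum.inr u)).card + 1 = (T.parents u).card := by
        rw [Finset.card_erase_add_one huK, hK.card_eq, (T.isNClique_parents u).card_eq]
      obtain ⟨x, hx, hxK⟩ : ∃ x ∈ T.parents u, x ∉ K.erase (Sum.inr u) := by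
        by_contra! h
        have := Finset.card_le_card (show T.parents u ⊆ _ from h)
        omega
      refine ⟨⟨u, x⟩, hx, ?_⟩
      have : K.erase (Sum.inr u) = (T.parents u).erase x := by
        refine Finset.eq_of_subset_of_card_le (fun w hw => ?_) ?_
        · exact Finset.mem_erase.2 ⟨fun h => hxK (h ▸ hw), hsubp hw⟩
        · rw [Finset.card_erase_of_mem hx]; omega
      show insert _ ((T.parents u).erase x) = K
      rw [← this, Finset.insert_erase huK]
    · rintro (rfl | ⟨⟨u, x⟩, hx, rfl⟩)
      · exact T.isNClique_rootNodes
      · replace hx : x ∈ T.parents u := hx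
        have h1 : T.graph.IsNClique (k - 1) ((T.parents u).erase x) :=
          (T.isNClique_parents u).erase_of_mem hx
        have hk : k - 1 + 1 = k := by
          have := (T.isNClique_parents u).card_eq
          have := Finset.card_pos.2 ⟨x, hx⟩
          omega
        have h2 := h1.insert (a := Sum.inr u) fun w hw =>
          have hw := Finset.mem_of_mem_erase hw
          (T.adj_iff_mem_parents (T.increasing u w hw)).2 hw
        rwa [hk] at h2
  have hmem : ∀ p : (Σ _ : Fin n, KTreeNode k n), Sum.inr p.1 ∈ g p :=
    fun p => Finset.mem_insert_self _ _
  have hlab : ∀ p : (Σ _ : Fin n, KTreeNode k n), ∀ w ∈ g p,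
      label w ≤ label (Sum.inr p.1 : KTreeNode k n) := by
    intro p w hw
    rcases Finset.mem_insert.1 hw with rfl | hw
    · exact le_rfl
    · exact (T.increasing _ w (Finset.mem_of_mem_erase hw)).le
  have hroot : rootNodes k n ∉ (Finset.univ.sigma T.parents).image g := by
    intro h
    obtain ⟨p, -, hp⟩ := Finset.mem_image.1 h
    have := hmem p
    rw [hp] at this
    simpa using label_eq_zero_of_mem_rootNodes this
  have hinj : Set.InjOn g (Finset.univ.sigma T.parents) := by
    rintro ⟨u, x⟩ hux ⟨v, y⟩ hvy h
    have huv : u = v := by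
      have h1 := hlab ⟨v, y⟩ _ (h ▸ hmem ⟨u, x⟩)
      have h2 := hlab ⟨u, x⟩ _ (h ▸ hmem ⟨v, y⟩)
      simp only [label_inr] at h1 h2
      exact Fin.ext (by omega)
    subst huv
    have hx : x ∈ T.parents u := by simpa using hux
    have hxg : x ∉ g ⟨u, x⟩ := by
      simp only [g, Finset.mem_insert, Finset.notMem_erase, or_false]
      rintro rfl
      exact T.inr_self_notMem_parents u hx
    have : x = y := by
      by_contra hxy
      rw [h] at hxg
      exact hxg (Finset.mem_insert_of_mem (Finset.mem_erase.2 ⟨hxy, hx⟩))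
    rw [this]
  rw [hset, Finset.sum_insert hroot, Finset.sum_image hinj, Finset.sum_sigma]

/-! ### Inserting the next node -/

/-- The places at which a new node can be inserted: as the last child of a `k`-clique, or
immediately before an existing node among the siblings of the latter. -/
abbrev Position (T : OrderedIncreasingKTree k n) : Type :=
  {K : Finset (KTreeNode k n) // T.graph.IsNClique k K} ⊕ Fin n

variable {T}

/-- The clique to which a node inserted at the given position is attached. -/
def Position.clique : T.Position → Finset (KTreeNode k n)
  | Sum.inl K => K
  | Sum.inr v => T.parents v

/-- `p.Before u`: the existing node `u`, if it is a child of `p.clique`, comes before a node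
inserted at position `p`. -/
def Position.Before : T.Position → Fin n → Prop
  | Sum.inl _ => fun _ => True
  | Sum.inr v => fun u => T.childLT u v

lemma Position.isNClique_clique (p : T.Position) : T.graph.IsNClique k p.clique := by
  rcases p with K | v
  · exact K.2
  · exact T.isNClique_parents v

lemma Position.before_of_childLT (p : T.Position) {u v : Fin n} (hv : p.Before v)
    (h : T.childLT u v) : p.Before u := by
  rcases p with K | w
  · trivial
  · exact T.childLT_trans _ _ _ h hv

/-- The graph of the tree that arises by joining a new node to the nodes of `p.clique`. -/
def Position.graph (p : T.Position) : SimpleGraph (KTreeNode k (n + 1)) :=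
  T.graph.map (castSuccEmb k n) ⊔
    SimpleGraph.fromRel fun x y => x = Sum.inr (Fin.last n) ∧ y ∈ p.clique.map (castSuccEmb k n)

/-- The parents in the tree that arises by joining a new node to the nodes of `p.clique`. -/
def Position.parents (p : T.Position) : Fin (n + 1) → Finset (KTreeNode k (n + 1)) :=
  Fin.lastCases (p.clique.map (castSuccEmb k n)) fun v => (T.parents v).map (castSuccEmb k n)

/-- The sibling orders in the tree that arises by inserting a new node at position `p`. -/
def Position.childLT (p : T.Position) (u v : Fin (n + 1)) : Prop :=
  Fin.lastCases (motive := fun _ => Prop)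
    (Fin.lastCases (motive := fun _ => Prop) False
      (fun v' => T.parents v' = p.clique ∧ ¬ p.Before v') v)
    (fun u' => Fin.lastCases (motive := fun _ => Prop)
      (T.parents u' = p.clique ∧ p.Before u') (fun v' => T.childLT u' v') v) u

namespace Position

variable (p : T.Position)

@[simp] lemma parents_last : p.parents (Fin.last n) = p.clique.map (castSuccEmb k n) := by
  simp [parents]

@[simp] lemma parents_castSucc (v : Fin n) :
    p.parents v.castSucc = (T.parents v).map (castSuccEmb k n) := by
  simp [parents]

@[simp] lemma childLT_last_last : ¬ p.childLT (Fin.last n) (Fin.last n) := by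
  simp [childLT]

@[simp] lemma childLT_last_castSucc (v : Fin n) :
    p.childLT (Fin.last n) v.castSucc ↔ T.parents v = p.clique ∧ ¬ p.Before v := by
  simp [childLT]

@[simp] lemma childLT_castSucc_last (u : Fin n) :
    p.childLT u.castSucc (Fin.last n) ↔ T.parents u = p.clique ∧ p.Before u := by
  simp [childLT]

@[simp] lemma childLT_castSucc_castSucc (u v : Fin n) :
    p.childLT u.castSucc v.castSucc ↔ T.childLT u v := by
  simp [childLT]

lemma graph_adj_castSuccEmb (x y : KTreeNode k n) :
    p.graph.Adj (castSuccEmb k n x) (castSuccEmb k n y) ↔ T.graph.Adj x y := by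
  simp [graph]

lemma graph_adj_last (y : KTreeNode k n) :
    p.graph.Adj (Sum.inr (Fin.last n)) (castSuccEmb k n y) ↔ y ∈ p.clique := by
  simp [graph, SimpleGraph.map_adj, (castSuccEmb_ne_last _).symm, Finset.mem_map',
    -Finset.mem_map]

lemma isNClique_map {K : Finset (KTreeNode k n)} (hK : T.graph.IsNClique k K) :
    p.graph.IsNClique k (K.map (castSuccEmb k n)) := by
  refine ⟨?_, by rw [Finset.card_map, hK.card_eq]⟩
  intro x hx y hy hxy
  simp only [Finset.coe_map, Set.mem_image] at hx hy
  obtain ⟨x, hx, rfl⟩ := hx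
  obtain ⟨y, hy, rfl⟩ := hy
  exact (p.graph_adj_castSuccEmb x y).2 (hK.1 hx hy fun h => hxy (by rw [h]))

lemma isRootedKTree_map {s : Finset (KTreeNode k n)} (h : IsRootedKTree T.graph T.parents s) :
    IsRootedKTree p.graph p.parents (s.map (castSuccEmb k n)) := by
  classical
  induction h with
  | root h =>
    rw [map_rootNodes]
    exact IsRootedKTree.root (map_rootNodes (k := k) (n := n) ▸ p.isNClique_map h)
  | attach s u hs hu hsub hcl hadj ih =>
    rw [Finset.map_insert, castSuccEmb_inr]
    refine IsRootedKTree.attach _ u.castSucc ih ?_ ?_ ?_ ?_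
    · rwa [← castSuccEmb_inr, Finset.mem_map']
    · rw [parents_castSucc]
      exact Finset.map_subset_map.2 hsub
    · rw [parents_castSucc]
      exact p.isNClique_map hcl
    · intro w' hw'
      obtain ⟨w, hw, rfl⟩ := Finset.mem_map.1 hw'
      rw [parents_castSucc, Finset.mem_map', ← castSuccEmb_inr, graph_adj_castSuccEmb]
      exact hadj w hw

lemma isRootedKTree : IsRootedKTree p.graph p.parents Finset.univ := by
  classical
  have huniv : insert (Sum.inr (Fin.last n)) (Finset.univ.map (castSuccEmb k n)) =
      (Finset.univ : Finset (KTreeNode k (n + 1))) := by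
    ext x
    by_cases hx : x = Sum.inr (Fin.last n)
    · simp [hx]
    · obtain ⟨y, rfl⟩ := exists_castSuccEmb_of_ne_last hx
      simp
  rw [← huniv]
  refine IsRootedKTree.attach _ _ (p.isRootedKTree_map T.isRootedKTree) (by simp) ?_ ?_ ?_
  · rw [parents_last]
    exact Finset.map_subset_map.2 (Finset.subset_univ _)
  · rw [parents_last]
    exact p.isNClique_map p.isNClique_clique
  · intro w hw
    obtain ⟨w, -, rfl⟩ := Finset.mem_map.1 hw
    rw [parents_last, Finset.mem_map', graph_adj_last]

/-- The tree that arises by inserting the node with the next label at position `p`. -/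
def extend (p : T.Position) : OrderedIncreasingKTree k (n + 1) where
  graph := p.graph
  parents := p.parents
  isRootedKTree := p.isRootedKTree
  increasing := by
    intro v w hw
    induction v using Fin.lastCases with
    | last =>
      rw [parents_last] at hw
      obtain ⟨w, -, rfl⟩ := Finset.mem_map.1 hw
      have := label_le w
      simpa [label_castSuccEmb] using Nat.lt_succ_of_le this
    | cast v =>
      rw [parents_castSucc] at hw
      obtain ⟨w, hw', rfl⟩ := Finset.mem_map.1 hw
      simpa [label_castSuccEmb] using T.increasing v w hw'
  childLT := p.childLT
  childLT_siblings := by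
    intro u v
    induction u using Fin.lastCases <;> induction v using Fin.lastCases
    · simp
    · simpa using fun h _ => h.symm
    · simpa using fun h _ => h
    · simpa using T.childLT_siblings _ _
  childLT_irrefl := by
    intro u
    induction u using Fin.lastCases
    · simp
    · simpa using T.childLT_irrefl _
  childLT_trans := by
    intro u v w
    induction u using Fin.lastCases with
    | last =>
      induction v using Fin.lastCases with
      | last => simp
      | cast v =>
        induction w using Fin.lastCases with
        | last =>
          simp only [childLT_last_castSucc, childLT_castSucc_last, childLT_last_last]
          tauto
        | cast w =>
          simp only [childLT_last_castSucc, childLT_castSucc_castSucc]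
          rintro ⟨h1, h2⟩ h
          exact ⟨(T.childLT_siblings _ _ h).symm.trans h1,
            fun hw => h2 (p.before_of_childLT hw h)⟩
    | cast u =>
      induction v using Fin.lastCases with
      | last =>
        induction w using Fin.lastCases with
        | last => simp
        | cast w =>
          simp only [childLT_last_castSucc, childLT_castSucc_castSucc, childLT_castSucc_last]
          rintro ⟨h1, h2⟩ ⟨h3, h4⟩
          have hne : u ≠ w := by rintro rfl; exact h4 h2
          exact (T.childLT_total u w (h1.trans h3.symm) hne).resolve_right
            fun h => h4 (p.before_of_childLT h2 h)
      | cast v =>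
        induction w using Fin.lastCases with
        | last =>
          simp only [childLT_castSucc_castSucc, childLT_castSucc_last]
          rintro h ⟨h1, h2⟩
          exact ⟨(T.childLT_siblings _ _ h).trans h1, p.before_of_childLT h2 h⟩
        | cast w =>
          simpa using T.childLT_trans u v w
  childLT_total := by
    intro u v
    induction u using Fin.lastCases <;> induction v using Fin.lastCases
    · simp
    · simp only [parents_last, parents_castSucc, Finset.map_inj, childLT_last_castSucc,
        childLT_castSucc_last]
      intro h _
      simp only [h, true_and]
      exact (em _).symm
    · simp only [parents_last, parents_castSucc, Finset.map_inj, childLT_last_castSucc,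
        childLT_castSucc_last]
      intro h _
      simp only [h, true_and]
      exact em _
    · simpa using T.childLT_total _ _

end Position

/-- Distinct trees, or distinct positions in one tree, give distinct extensions: a position is
determined by its clique `K` and by the children of `K` that come before it. -/
lemma extend_injective :
    Function.Injective fun q : (Σ T : OrderedIncreasingKTree k n, T.Position) => q.2.extend := by
  rintro ⟨T, p⟩ ⟨T', q⟩ h
  have hpar : p.parents = q.parents := congrArg OrderedIncreasingKTree.parents h
  have hlt : p.childLT = q.childLT := congrArg OrderedIncreasingKTree.childLT h
  have hT : T = T' := by
    refine ext_of_parents ?_ ?_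
    · funext v
      have := congrFun hpar v.castSucc
      simpa using this
    · funext u v
      have := congrFun (congrFun hlt u.castSucc) v.castSucc
      simpa using this
  subst hT
  have hcl : p.clique = q.clique := by simpa using congrFun hpar (Fin.last n)
  have hbef : ∀ v, T.parents v = p.clique → (p.Before v ↔ q.Before v) := fun v hv => by
    have := congrFun (congrFun hlt v.castSucc) (Fin.last n)
    simpa [hv, hcl] using this
  have hpq : p = q := by
    rcases p with K | v <;> rcases q with L | w
    · exact congrArg Sum.inl (Subtype.ext hcl)
    · exact absurd ((hbef w hcl.symm).1 trivial) (T.childLT_irrefl w)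
    · exact absurd ((hbef v rfl).2 trivial) (T.childLT_irrefl v)
    · by_contra hne
      have hvw : v ≠ w := fun h => hne (by rw [h])
      rcases T.childLT_total v w hcl hvw with h | h
      · exact T.childLT_irrefl v ((hbef v rfl).2 h)
      · exact T.childLT_irrefl w ((hbef w hcl.symm).1 h)
  rw [hpq]

/-- Removing the node with the largest label, as far as the parent sets are concerned. -/
noncomputable def restrictParents (T' : OrderedIncreasingKTree k (n + 1)) (v : Fin (n + 1)) :
    Finset (KTreeNode k n) :=
  (T'.parents v).preimage (castSuccEmb k n) (castSuccEmb k n).injective.injOn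

lemma map_restrictParents (T' : OrderedIncreasingKTree k (n + 1)) (v : Fin (n + 1)) :
    (T'.restrictParents v).map (castSuccEmb k n) = T'.parents v := by
  ext w
  simp only [restrictParents, Finset.mem_map, Finset.mem_preimage]
  constructor
  · rintro ⟨x, hx, rfl⟩
    exact hx
  · intro hw
    obtain ⟨y, rfl⟩ : ∃ y, castSuccEmb k n y = w := by
      refine exists_castSuccEmb_of_ne_last ?_
      rintro rfl
      have h1 := T'.increasing v _ hw
      have h2 := v.2
      simp at h1
      omega
    exact ⟨y, hw, rfl⟩

lemma isNClique_restrictParents (T' : OrderedIncreasingKTree k (n + 1)) (v : Fin (n + 1)) :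
    (T'.graph.comap (castSuccEmb k n)).IsNClique k (T'.restrictParents v) := by
  have h := T'.isNClique_parents v
  refine ⟨?_, ?_⟩
  · intro x hx y hy hxy
    have hx' : castSuccEmb k n x ∈ T'.parents v := by simpa [restrictParents] using hx
    have hy' : castSuccEmb k n y ∈ T'.parents v := by simpa [restrictParents] using hy
    exact h.1 hx' hy' fun he => hxy ((castSuccEmb k n).injective he)
  · rw [← Finset.card_map (castSuccEmb k n), map_restrictParents, h.card_eq]

lemma isRootedKTree_comap (T' : OrderedIncreasingKTree k (n + 1))
    {s : Finset (KTreeNode k (n + 1))} (h : IsRootedKTree T'.graph T'.parents s) :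
    IsRootedKTree (T'.graph.comap (castSuccEmb k n)) (fun v => T'.restrictParents v.castSucc)
      (s.preimage (castSuccEmb k n) (castSuccEmb k n).injective.injOn) := by
  classical
  induction h with
  | root h =>
    have : (rootNodes k (n + 1)).preimage (castSuccEmb k n) (castSuccEmb k n).injective.injOn =
        rootNodes k n := by
      rw [← map_rootNodes, Finset.preimage_map]
    rw [this]
    refine IsRootedKTree.root ⟨?_, by simp [rootNodes]⟩
    intro x hx y hy hxy
    have hmem : ∀ {x}, x ∈ rootNodes k n → castSuccEmb k n x ∈ rootNodes k (n + 1) := fun hx => by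
      rw [← map_rootNodes]
      exact Finset.mem_map_of_mem _ hx
    exact h.1 (hmem hx) (hmem hy) fun he => hxy ((castSuccEmb k n).injective he)
  | attach s u hs hu hsub hcl hadj ih =>
    induction u using Fin.lastCases with
    | last =>
      convert ih using 1
      ext x
      simp
    | cast u =>
      have : (insert (Sum.inr u.castSucc) s).preimage (castSuccEmb k n)
          (castSuccEmb k n).injective.injOn =
          insert (Sum.inr u) (s.preimage (castSuccEmb k n) (castSuccEmb k n).injective.injOn) := by
        ext x
        simp only [Finset.mem_preimage, Finset.mem_insert]
        rw [← castSuccEmb_inr, (castSuccEmb k n).injective.eq_iff]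
      rw [this]
      refine IsRootedKTree.attach _ u ih ?_ ?_ (T'.isNClique_restrictParents _) ?_
      · simpa using hu
      · intro x hx
        simp only [restrictParents, Finset.mem_preimage] at hx ⊢
        exact hsub hx
      · intro w hw
        simp only [restrictParents, Finset.mem_preimage, SimpleGraph.comap_adj] at hw ⊢
        exact hadj _ hw

/-- The tree that arises by removing the node with the largest label. -/
noncomputable def restrict (T' : OrderedIncreasingKTree k (n + 1)) :
    OrderedIncreasingKTree k n where
  graph := T'.graph.comap (castSuccEmb k n)
  parents v := T'.restrictParents v.castSucc
  isRootedKTree := by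
    have := T'.isRootedKTree_comap T'.isRootedKTree
    rwa [Finset.preimage_univ] at this
  increasing := by
    intro v w hw
    have : castSuccEmb k n w ∈ T'.parents v.castSucc := by simpa [restrictParents] using hw
    simpa [label_castSuccEmb] using T'.increasing _ _ this
  childLT u v := T'.childLT u.castSucc v.castSucc
  childLT_siblings u v h := by
    simp only [restrictParents, T'.childLT_siblings _ _ h]
  childLT_irrefl u := T'.childLT_irrefl _
  childLT_trans u v w := T'.childLT_trans _ _ _
  childLT_total u v h huv := by
    refine T'.childLT_total _ _ ?_ (by simpa using huv)
    rw [← map_restrictParents, h, map_restrictParents]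

/-- Every tree arises from the tree without its last node: among its siblings, the last node comes
either at the end, or immediately before the first of the siblings that are larger than it. -/
lemma extend_surjective :
    Function.Surjective fun q : (Σ T : OrderedIncreasingKTree k n, T.Position) => q.2.extend := by
  intro T'
  obtain ⟨p, hp, hb⟩ : ∃ p : T'.restrict.Position, p.clique = T'.restrictParents (Fin.last n) ∧
      ∀ u : Fin n, T'.parents u.castSucc = T'.parents (Fin.last n) →
        (p.Before u ↔ T'.childLT u.castSucc (Fin.last n)) := by
    let S : Set (Fin n) := {u | T'.parents u.castSucc = T'.parents (Fin.last n) ∧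
      ¬ T'.childLT u.castSucc (Fin.last n)}
    rcases S.eq_empty_or_nonempty with hS | hS
    · refine ⟨Sum.inl ⟨_, T'.isNClique_restrictParents (Fin.last n)⟩, rfl, fun u hu => ?_⟩
      refine iff_of_true trivial ?_
      by_contra h
      have : u ∈ S := ⟨hu, h⟩
      simp [hS] at this
    · have : IsTrans (Fin n) T'.restrict.childLT := ⟨T'.restrict.childLT_trans⟩
      have : Std.Irrefl T'.restrict.childLT := ⟨T'.restrict.childLT_irrefl⟩
      have hwf : WellFounded T'.restrict.childLT := Finite.wellFounded_of_trans_of_irrefl _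
      obtain ⟨v, ⟨hv, hv'⟩, hmin⟩ := hwf.has_min S hS
      refine ⟨Sum.inr v, ?_, fun u hu => ⟨fun h => ?_, fun h => ?_⟩⟩
      · show T'.restrictParents v.castSucc = _
        simp only [restrictParents, hv]
      · by_contra hcon
        exact hmin u ⟨hu, hcon⟩ h
      · have huv : u.castSucc ≠ v.castSucc := by
          rintro he
          exact hv' (he ▸ h)
        exact (T'.childLT_total _ _ (hu.trans hv.symm) huv).resolve_right
          fun h' => hv' (T'.childLT_trans _ _ _ h' h)
  refine ⟨⟨T'.restrict, p⟩, ext_of_parents ?_ ?_⟩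
  · funext v
    show p.parents v = _
    induction v using Fin.lastCases with
    | last => rw [Position.parents_last, hp, map_restrictParents]
    | cast v =>
      rw [Position.parents_castSucc]
      exact T'.map_restrictParents _
  · have hsib : ∀ u : Fin n, T'.restrict.parents u = p.clique ↔
        T'.parents u.castSucc = T'.parents (Fin.last n) := fun u => by
      rw [hp, ← Finset.map_inj (f := castSuccEmb k n), map_restrictParents]
      exact (T'.map_restrictParents u.castSucc).symm ▸ Iff.rfl
    funext u v
    apply propext
    show p.childLT u v ↔ _
    induction u using Fin.lastCases with
    | last =>
      induction v using Fin.lastCases with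
      | last => simpa using T'.childLT_irrefl _
      | cast v =>
        rw [Position.childLT_last_castSucc, hsib]
        constructor
        · rintro ⟨h1, h2⟩
          rw [hb v h1] at h2
          exact (T'.childLT_total _ _ h1 (Fin.castSucc_ne_last v)).resolve_left h2
        · intro h
          have h1 := (T'.childLT_siblings _ _ h).symm
          refine ⟨h1, fun h2 => ?_⟩
          exact T'.childLT_irrefl _ (T'.childLT_trans _ _ _ h ((hb v h1).1 h2))
    | cast u =>
      induction v using Fin.lastCases with
      | last =>
        rw [Position.childLT_castSucc_last, hsib]
        constructor
        · rintro ⟨h1, h2⟩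
          exact (hb u h1).1 h2
        · intro h
          have h1 := T'.childLT_siblings _ _ h
          exact ⟨h1, (hb u h1).2 h⟩
      | cast v =>
        rw [Position.childLT_castSucc_castSucc]
        rfl

end OrderedIncreasingKTree

namespace OrderedIncreasingKTree

open KTreeNode

variable {k n : ℕ}

/-! ### Evolution of the out-degree -/

open Classical in
lemma outDegree_eq_card (T : OrderedIncreasingKTree k n) (u : Fin n) :
    T.outDegree (u + 1) = (Finset.univ.filter fun v => Sum.inr u ∈ T.parents v).card := by
  unfold outDegree
  refine congrArg Finset.card (Finset.ext fun v => ?_)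
  constructor
  · intro h
    obtain ⟨w, hw, hv⟩ := (Finset.mem_filter.1 h).2
    obtain rfl : w = u := Fin.ext (by simpa using hw)
    exact Finset.mem_filter.2 ⟨Finset.mem_univ _, hv⟩
  · intro h
    exact Finset.mem_filter.2 ⟨Finset.mem_univ _, u, rfl, (Finset.mem_filter.1 h).2⟩

open Classical in
noncomputable instance (T : OrderedIncreasingKTree k n) : Fintype T.Position :=
  inferInstance

noncomputable instance : Fintype (OrderedIncreasingKTree k n) := Fintype.ofFinite _

open Classical in
lemma outDegree_extend {T : OrderedIncreasingKTree k n} (p : T.Position) (u : Fin n) :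
    p.extend.outDegree (u + 1) = T.outDegree (u + 1) + if Sum.inr u ∈ p.clique then 1 else 0 := by
  have h := p.extend.outDegree_eq_card u.castSucc
  rw [Fin.val_castSucc] at h
  rw [h, outDegree_eq_card, Finset.card_filter, Finset.card_filter, Fin.sum_univ_castSucc]
  have h1 : ∀ v, p.extend.parents v = p.parents v := fun _ => rfl
  simp only [h1, Position.parents_castSucc, Position.parents_last, ← castSuccEmb_inr,
    Finset.mem_map']

lemma outDegree_last (T : OrderedIncreasingKTree k (n + 1)) : T.outDegree (n + 1) = 0 := by
  classical
  have h := T.outDegree_eq_card (Fin.last n)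
  rw [Fin.val_last] at h
  rw [h, Finset.card_eq_zero, Finset.filter_eq_empty_iff]
  intro v _ hv
  have h1 := T.increasing v _ hv
  have h2 := v.2
  rw [label_inr, label_inr, Fin.val_last] at h1
  omega

open Classical in
lemma card_isNClique (T : OrderedIncreasingKTree k n) :
    (Finset.univ.filter fun K => T.graph.IsNClique k K).card = 1 + n * k := by
  rw [Finset.card_eq_sum_ones, sum_isNClique]
  simp [(T.isNClique_parents _).card_eq]

lemma card_position (T : OrderedIncreasingKTree k n) :
    Fintype.card T.Position = 1 + n * (k + 1) := by
  classical
  rw [Fintype.card_sum, Fintype.card_subtype, Fintype.card_fin]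
  have := T.card_isNClique
  rw [show (Finset.univ.filter fun K => T.graph.IsNClique k K).card = 1 + n * k by
    convert this]
  ring

open Classical in
/-- A node `u` of out-degree `d` lies in `k` cliques from the time of its insertion on, and in
`k - 1` further ones for each of its children. -/
lemma sum_isNClique_mem (T : OrderedIncreasingKTree k n) (u : Fin n) :
    (∑ K with T.graph.IsNClique k K, if Sum.inr u ∈ K then 1 else 0) =
      k + T.outDegree (u + 1) * (k - 1) := by
  have hstep : ∀ v, (∑ x ∈ T.parents v,
      if Sum.inr u ∈ insert (Sum.inr v) ((T.parents v).erase x) then 1 else 0) =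
      (if v = u then k else 0) + if Sum.inr u ∈ T.parents v then k - 1 else 0 := by
    intro v
    by_cases hvu : v = u
    · subst hvu
      simp [T.inr_self_notMem_parents, (T.isNClique_parents _).card_eq]
    · have h1 : (Sum.inr u : KTreeNode k n) ≠ Sum.inr v := by simpa [eq_comm] using hvu
      by_cases hu : Sum.inr u ∈ T.parents v
      · simp only [Finset.mem_insert, h1, false_or, Finset.mem_erase, hu, and_true, hvu, if_true,
          if_false, zero_add]
        rw [← Finset.card_filter, Finset.filter_ne, Finset.card_erase_of_mem hu,
          (T.isNClique_parents v).card_eq]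
      · simp [h1, hu, hvu]
  rw [sum_isNClique, Finset.sum_congr rfl fun v _ => hstep v, Finset.sum_add_distrib,
    outDegree_eq_card, Finset.card_filter, Finset.sum_mul]
  simp [rootNodes]

open Classical in
lemma card_position_mem (hk : 1 ≤ k) (T : OrderedIncreasingKTree k n) (u : Fin n) :
    (∑ p : T.Position, if Sum.inr u ∈ p.clique then 1 else 0) =
      k * (T.outDegree (u + 1) + 1) := by
  have h1 := T.sum_isNClique_mem u
  rw [Finset.sum_subtype (p := fun K => T.graph.IsNClique k K) _ (by simp)] at h1
  have h2 := T.outDegree_eq_card u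
  rw [Finset.card_filter] at h2
  refine (Fintype.sum_sum_type _).trans ?_
  show (∑ K : {K // T.graph.IsNClique k K}, if Sum.inr u ∈ K.1 then 1 else 0) +
    (∑ v, if Sum.inr u ∈ T.parents v then 1 else 0) = _
  rw [← h2]
  have h3 : ∀ d, k + d * (k - 1) + d = k * (d + 1) := by
    intro d
    obtain ⟨k', hk'⟩ : ∃ k', k = k' + 1 := ⟨k - 1, by omega⟩
    rw [hk', Nat.add_sub_cancel]
    ring
  rw [← h3, ← h1]

open Classical in
/-- The fundamental recursion: a tree of size `n` in which `u` has out-degree `d` has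
`1 + n (k + 1)` extensions, and in `k (d + 1)` of them the out-degree of `u` is `d + 1`. -/
lemma sum_outDegree_succ (hk : 1 ≤ k) (u : Fin n) (f : ℕ → ℝ) :
    ∑ T : OrderedIncreasingKTree k (n + 1), f (T.outDegree (u + 1)) =
      ∑ T : OrderedIncreasingKTree k n,
        ((1 + n * (k + 1)) * f (T.outDegree (u + 1)) + k * (T.outDegree (u + 1) + 1) *
          (f (T.outDegree (u + 1) + 1) - f (T.outDegree (u + 1)))) := by
  rw [← Function.Bijective.sum_comp (e := fun q : (Σ T : OrderedIncreasingKTree k n, T.Position) =>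
    q.2.extend) ⟨extend_injective, extend_surjective⟩ (fun T => f (T.outDegree (u + 1))),
    Fintype.sum_sigma]
  refine Finset.sum_congr rfl fun T _ => ?_
  have h1 : ∀ p : T.Position, f (p.extend.outDegree (u + 1)) = f (T.outDegree (u + 1)) +
      (if Sum.inr u ∈ p.clique then 1 else 0) *
        (f (T.outDegree (u + 1) + 1) - f (T.outDegree (u + 1))) := by
    intro p
    rw [outDegree_extend]
    split_ifs <;> simp
  simp only [h1]
  rw [Finset.sum_add_distrib, ← Finset.sum_mul, Finset.sum_const, Finset.card_univ, card_position]
  have h2 := congrArg (Nat.cast (R := ℝ)) (T.card_position_mem hk u)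
  push_cast at h2
  rw [h2]
  simp

lemma card_succ : Fintype.card (OrderedIncreasingKTree k (n + 1)) =
    Fintype.card (OrderedIncreasingKTree k n) * (1 + n * (k + 1)) := by
  rw [← Fintype.card_congr (Equiv.ofBijective
    (fun q : (Σ T : OrderedIncreasingKTree k n, T.Position) => q.2.extend)
    ⟨extend_injective, extend_surjective⟩), Fintype.card_sigma,
    Finset.sum_congr rfl fun T _ => T.card_position, Finset.sum_const, Finset.card_univ,
    smul_eq_mul]

/-! ### The uniform measure -/

instance : MeasurableSingletonClass (OrderedIncreasingKTree k n) := ⟨fun _ => trivial⟩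

lemma integral_randomKTree (f : OrderedIncreasingKTree k n → ℝ) :
    ∫ T, f T ∂randomKTree k n =
      (∑ T, f T) / Fintype.card (OrderedIncreasingKTree k n) := by
  rw [integral_fintype (Integrable.of_finite), Finset.sum_div]
  refine Finset.sum_congr rfl fun T _ => ?_
  rw [randomKTree, measureReal_def, uniformOn_univ]
  simp [div_eq_inv_mul]

/-- One step of the Markov chain of out-degrees: given the out-degree `d` in the tree of size `n`,
it increases by one with probability `k (d + 1) / (1 + n (k + 1))`. -/
lemma integral_outDegree_succ (hk : 1 ≤ k) {j : ℕ} (hj : 1 ≤ j) (hjn : j ≤ n) (f : ℕ → ℝ) :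
    ∫ T, f (T.outDegree j) ∂randomKTree k (n + 1) =
      ∫ T, (f (T.outDegree j) + k / (k + 1) / (n + 1 - k / (k + 1)) * ((T.outDegree j + 1) *
        (f (T.outDegree j + 1) - f (T.outDegree j)))) ∂randomKTree k n := by
  obtain ⟨u, rfl⟩ : ∃ u : Fin n, (u : ℕ) + 1 = j := ⟨⟨j - 1, by omega⟩, by simp; omega⟩
  rw [integral_randomKTree, integral_randomKTree, sum_outDegree_succ hk, card_succ]
  have hc : (Fintype.card (OrderedIncreasingKTree k n) : ℝ) ≠ 0 :=
    Nat.cast_ne_zero.2 Fintype.card_ne_zero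
  have h1 : (0 : ℝ) < 1 + n * (k + 1) := by positivity
  have h2 : ((n : ℝ) + 1 - k / (k + 1)) = (1 + n * (k + 1)) / (k + 1) := by
    field_simp
    ring
  rw [Finset.sum_div, Finset.sum_div]
  refine Finset.sum_congr rfl fun T _ => ?_
  rw [h2]
  push_cast
  field_simp

lemma integral_outDegree_self {j : ℕ} (hj : 1 ≤ j) (f : ℕ → ℝ) :
    ∫ T, f (T.outDegree j) ∂randomKTree k j = f 0 := by
  obtain ⟨n, rfl⟩ : ∃ n, j = n + 1 := ⟨j - 1, by omega⟩
  simp [outDegree_last]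

end OrderedIncreasingKTree

/-! ### Products of the form `∏ (1 + c / (i + b))` -/

/-- Euler's limit formula for the Gamma function, as an asymptotic equivalent of a product. -/
lemma tendsto_rpow_mul_prod_one_add_div {b c : ℝ} {j : ℕ} (hb : 0 < b) (hc : 0 < j + b + c) :
    Tendsto (fun n : ℕ => (n : ℝ) ^ (-c) * ∏ i ∈ Finset.Ico j n, (1 + c / (i + b))) atTop
      (𝓝 (Real.Gamma (j + b) / Real.Gamma (j + b + c))) := by
  rw [← tendsto_add_atTop_iff_nat (j + 1)]
  have hlim : Tendsto (fun m : ℕ => ((m : ℝ) / (m + (j + 1))) ^ c *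
      (Real.GammaSeq (j + b) m / Real.GammaSeq (j + b + c) m)) atTop
      (𝓝 (1 ^ c * (Real.Gamma (j + b) / Real.Gamma (j + b + c)))) := by
    refine Tendsto.mul ?_ ((Real.GammaSeq_tendsto_Gamma _).div (Real.GammaSeq_tendsto_Gamma _)
      (Real.Gamma_pos_of_pos hc).ne')
    exact (tendsto_natCast_div_add_atTop ((j : ℝ) + 1)).rpow_const (Or.inl one_ne_zero)
  rw [Real.one_rpow, one_mul] at hlim
  refine hlim.congr' ?_
  filter_upwards [eventually_gt_atTop 0] with m hm
  have hm' : (0 : ℝ) < m := Nat.cast_pos.2 hm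
  have hprod : ∏ i ∈ Finset.Ico j (m + (j + 1)), (1 + c / ((i : ℝ) + b)) =
      (∏ i ∈ Finset.range (m + 1), ((j : ℝ) + b + c + i)) /
        ∏ i ∈ Finset.range (m + 1), ((j : ℝ) + b + i) := by
    rw [Finset.prod_Ico_eq_prod_range, ← Finset.prod_div_distrib,
      show m + (j + 1) - j = m + 1 by omega]
    refine Finset.prod_congr rfl fun i _ => ?_
    have : (j : ℝ) + b + i ≠ 0 := by positivity
    push_cast
    rw [show (j : ℝ) + i + b = j + b + i by ring]
    field_simp
    ring
  rw [hprod]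
  have h1 : ∏ i ∈ Finset.range (m + 1), ((j : ℝ) + b + i) ≠ 0 :=
    Finset.prod_ne_zero_iff.2 fun i _ => by positivity
  have h2 : ∏ i ∈ Finset.range (m + 1), ((j : ℝ) + b + c + i) ≠ 0 :=
    Finset.prod_ne_zero_iff.2 fun i _ => by positivity
  have h3 : ((m + (j + 1) : ℕ) : ℝ) = m + (j + 1) := by push_cast; ring
  have h4 : (0 : ℝ) < m + (j + 1) := by positivity
  rw [Real.GammaSeq, Real.GammaSeq, h3, Real.div_rpow hm'.le h4.le, Real.rpow_add hm' (j + b) c,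
    Real.rpow_neg h4.le]
  have h5 := (Real.rpow_pos_of_pos hm' c).ne'
  have h6 := (Real.rpow_pos_of_pos hm' (j + b)).ne'
  have h7 := (Real.rpow_pos_of_pos h4 c).ne'
  have h8 : (m.factorial : ℝ) ≠ 0 := Nat.cast_ne_zero.2 m.factorial_ne_zero
  field_simp

/-- If the lower end of the product also tends to infinity, the Gamma factors cancel. -/
lemma tendsto_div_rpow_mul_prod_one_add_div {b : ℝ} (c : ℝ) (hb : 0 < b) {j : ℕ → ℕ}
    (hj : Tendsto j atTop atTop) (hjn : ∀ᶠ n in atTop, j n ≤ n) :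
    Tendsto (fun n : ℕ => ((j n : ℝ) / n) ^ c * ∏ i ∈ Finset.Ico (j n) n, (1 + c / (i + b)))
      atTop (𝓝 1) := by
  obtain ⟨N, hN⟩ := exists_nat_gt (-c)
  have hN' : (0 : ℝ) < N + b + c := by linarith
  have hL := tendsto_rpow_mul_prod_one_add_div hb hN'
  have hL0 : Real.Gamma (N + b) / Real.Gamma (N + b + c) ≠ 0 :=
    (div_pos (Real.Gamma_pos_of_pos (by positivity)) (Real.Gamma_pos_of_pos hN')).ne'
  have hlim := hL.div (hL.comp hj) hL0
  rw [div_self hL0] at hlim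
  refine hlim.congr' ?_
  filter_upwards [hjn, hj.eventually_ge_atTop N, hj.eventually_gt_atTop 0] with n h1 h2 h3
  have hj0 : (0 : ℝ) < j n := Nat.cast_pos.2 h3
  have hn0 : (0 : ℝ) < n := hj0.trans_le (Nat.cast_le.2 h1)
  have hpos : 0 < ∏ i ∈ Finset.Ico N (j n), (1 + c / ((i : ℝ) + b)) := by
    refine Finset.prod_pos fun i hi => ?_
    have hi : (N : ℝ) ≤ i := Nat.cast_le.2 (Finset.mem_Ico.1 hi).1
    have : 0 < (i : ℝ) + b := by positivity
    rw [← div_self this.ne', ← add_div]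
    exact div_pos (by linarith) this
  simp only [Pi.div_apply, Function.comp_apply]
  rw [← Finset.prod_Ico_consecutive _ h2 h1, Real.div_rpow hj0.le hn0.le, Real.rpow_neg hj0.le,
    Real.rpow_neg hn0.le]
  have h5 := (Real.rpow_pos_of_pos hj0 c).ne'
  have h6 := (Real.rpow_pos_of_pos hn0 c).ne'
  have h7 := hpos.ne'
  generalize ∏ i ∈ Finset.Ico N (j n), (1 + c / ((i : ℝ) + b)) = P at h7 ⊢
  generalize ∏ i ∈ Finset.Ico (j n) n, (1 + c / ((i : ℝ) + b)) = Q
  field_simp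


lemma Ring.choose_natCast_add {n j : ℕ} (hjn : j ≤ n) (x : ℝ) :
    Ring.choose ((n : ℝ) + x) (n - j) =
      (∏ i ∈ Finset.Ico j n, ((i : ℝ) + 1 + x)) / ((n - j).factorial : ℝ) := by
  have h := Ring.descPochhammer_eq_factorial_smul_choose ((n : ℝ) + x) (n - j)
  have hasc : ∀ (m : ℕ) (y : ℝ),
      (ascPochhammer ℕ m).smeval y = ∏ i ∈ Finset.range m, (y + i) := by
    intro m y
    induction m with
    | zero => simp
    | succ m ih =>
      rw [ascPochhammer_succ_right, Polynomial.smeval_mul, ih, Finset.prod_range_succ,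
        Polynomial.smeval_add, Polynomial.smeval_X, Polynomial.smeval_natCast]
      simp
  rw [Polynomial.descPochhammer_smeval_eq_ascPochhammer, hasc, nsmul_eq_mul] at h
  rw [eq_div_iff (Nat.cast_ne_zero.2 (Nat.factorial_ne_zero _)), mul_comm, ← h,
    Finset.prod_Ico_eq_prod_range]
  refine Finset.prod_congr rfl fun i _ => ?_
  push_cast [hjn]
  ring

namespace OrderedIncreasingKTree

/-! ### Exact distribution and moments of the out-degree -/

variable {k : ℕ}

/-- The exact distribution. As functions of `n`, both sides satisfy the forward equation of the
Markov chain of out-degrees. -/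
lemma randomKTree_real_outDegree_eq (hk : 1 ≤ k) {j n : ℕ} (hj : 1 ≤ j) (hjn : j ≤ n) (m : ℕ) :
    (randomKTree k n).real {T | T.outDegree j = m} =
      ∑ l ∈ Finset.range (m + 1), (m.choose l : ℝ) * (-1) ^ l *
        ∏ i ∈ Finset.Ico j n,
          (1 + -(k / (k + 1) * (l + 1)) / ((i : ℝ) + (1 - k / (k + 1)))) := by
  have hint : ∀ n m, (randomKTree k n).real {T | T.outDegree j = m} =
      ∫ T, (if T.outDegree j = m then (1 : ℝ) else 0) ∂randomKTree k n := by
    intro n m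
    rw [← integral_indicator_one (MeasurableSpace.measurableSet_top)]
    simp [Set.indicator_apply]
  induction n, hjn using Nat.le_induction generalizing m with
  | base =>
    rw [hint, integral_outDegree_self hj fun d => if d = m then (1 : ℝ) else 0]
    simp only [Finset.Ico_self, Finset.prod_empty, mul_one]
    have := Int.alternating_sum_range_choose (n := m)
    have h2 := congrArg (Int.cast (R := ℝ)) this
    push_cast at h2
    rw [← Finset.sum_congr rfl fun l _ => mul_comm ((-1 : ℝ) ^ l) _, h2]
    simp [eq_comm]
  | succ n hjn ih =>
    rw [hint, integral_outDegree_succ hk hj hjn fun d => if d = m then (1 : ℝ) else 0]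
    set c : ℝ := k / (k + 1) / (n + 1 - k / (k + 1)) with hc
    have hfac : ∀ l : ℕ, (1 + -(k / (k + 1) * ((l : ℝ) + 1)) / ((n : ℝ) + (1 - k / (k + 1)))) =
        1 - c * (l + 1) := by
      intro l
      rw [hc, add_sub_assoc]
      ring
    simp only [Finset.prod_Ico_succ_top hjn, hfac]
    cases m with
    | zero =>
      have h1 : ∀ d : ℕ, ((if d = 0 then (1 : ℝ) else 0) + c * (((d : ℝ) + 1) *
          ((if d + 1 = 0 then 1 else 0) - if d = 0 then 1 else 0))) =
          (1 - c) * if d = 0 then 1 else 0 := by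
        intro d
        by_cases hd : d = 0
        · simp [hd]; ring
        · simp [hd]
      simp only [h1]
      rw [integral_const_mul, ← hint, ih]
      simp
      ring
    | succ m =>
      have h1 : ∀ d : ℕ, ((if d = m + 1 then (1 : ℝ) else 0) + c * (((d : ℝ) + 1) *
          ((if d + 1 = m + 1 then 1 else 0) - if d = m + 1 then 1 else 0))) =
          (1 - c * (m + 2)) * (if d = m + 1 then 1 else 0) +
            c * (m + 1) * (if d = m then 1 else 0) := by
        intro d
        by_cases hd : d = m + 1
        · subst hd; simp; ring
        · by_cases hd' : d = m
          · subst hd'; simp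
          · simp [hd, hd']
      simp only [h1]
      rw [integral_add Integrable.of_finite Integrable.of_finite, integral_const_mul,
        integral_const_mul, ← hint, ← hint, ih, ih]
      have hext : ∑ l ∈ Finset.range (m + 1), (m.choose l : ℝ) * (-1) ^ l *
          ∏ i ∈ Finset.Ico j n, (1 + -(k / (k + 1) * ((l : ℝ) + 1)) / ((i : ℝ) + (1 - k / (k + 1))))
          = ∑ l ∈ Finset.range (m + 1 + 1), (m.choose l : ℝ) * (-1) ^ l *
          ∏ i ∈ Finset.Ico j n,
            (1 + -(k / (k + 1) * ((l : ℝ) + 1)) / ((i : ℝ) + (1 - k / (k + 1)))) := by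
        rw [Finset.sum_range_succ _ (m + 1)]
        simp
      rw [hext, Finset.mul_sum, Finset.mul_sum, ← Finset.sum_add_distrib]
      refine Finset.sum_congr rfl fun l hl => ?_
      have hl' : l ≤ m + 1 := by simpa [Nat.lt_succ_iff] using hl
      -- the absorption identity for binomial coefficients
      have hch : ((m : ℝ) + 1) * m.choose l = (m + 1).choose l * (m + 1 - l) := by
        have := Nat.choose_mul_succ_eq m l
        have h2 := congrArg (Nat.cast (R := ℝ)) this
        push_cast [hl'] at h2
        rw [mul_comm, h2]
      linear_combination c * (-1) ^ l * (∏ i ∈ Finset.Ico j n,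
        (1 + -(k / (k + 1) * ((l : ℝ) + 1)) / ((i : ℝ) + (1 - k / (k + 1))))) * hch

/-- The exact distribution, in terms of generalized binomial coefficients. -/
lemma randomKTree_real_outDegree_eq_choose (hk : 1 ≤ k) {j n : ℕ} (hj : 1 ≤ j) (hjn : j ≤ n)
    (m : ℕ) :
    (randomKTree k n).real {T | T.outDegree j = m} =
      Ring.choose ((j : ℝ) - k / (k + 1)) j
          / (Ring.choose ((n : ℝ) - k / (k + 1)) n * (n.choose j : ℝ))
        * ∑ l ∈ Finset.range (m + 1), (m.choose l : ℝ) * (-1) ^ l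
            * Ring.choose ((n : ℝ) - k * (2 + l) / (k + 1)) (n - j) := by
  have ha : (k : ℝ) / (k + 1) < 1 := by
    rw [div_lt_one (by positivity)]
    linarith
  have hpos : ∀ i : ℕ, (0 : ℝ) < (i : ℝ) + 1 + -(k / (k + 1)) := fun i => by
    have : (0 : ℝ) ≤ i := Nat.cast_nonneg i
    linarith
  have h0 : ∀ n : ℕ, Ring.choose ((n : ℝ) - k / (k + 1)) n =
      (∏ i ∈ Finset.range n, ((i : ℝ) + 1 + -(k / (k + 1)))) / (n.factorial : ℝ) := by
    intro n
    have := Ring.choose_natCast_add (Nat.zero_le n) (-((k : ℝ) / (k + 1)))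
    rwa [← sub_eq_add_neg, Nat.sub_zero, ← Finset.range_eq_Ico] at this
  rw [randomKTree_real_outDegree_eq hk hj hjn, Finset.mul_sum]
  refine Finset.sum_congr rfl fun l _ => ?_
  have h1 : Ring.choose ((n : ℝ) - k * (2 + l) / (k + 1)) (n - j) =
      (∏ i ∈ Finset.Ico j n, ((i : ℝ) + 1 + -(k * (2 + l) / (k + 1)))) /
        ((n - j).factorial : ℝ) := by
    rw [sub_eq_add_neg, Ring.choose_natCast_add hjn]
  have h2 : ∏ i ∈ Finset.Ico j n,
      (1 + -((k : ℝ) / (k + 1) * (l + 1)) / ((i : ℝ) + (1 - k / (k + 1)))) =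
      (∏ i ∈ Finset.Ico j n, ((i : ℝ) + 1 + -(k * (2 + l) / (k + 1)))) /
        ∏ i ∈ Finset.Ico j n, ((i : ℝ) + 1 + -(k / (k + 1))) := by
    rw [← Finset.prod_div_distrib]
    refine Finset.prod_congr rfl fun i _ => ?_
    have h3 := (hpos i).ne'
    rw [show (i : ℝ) + (1 - k / (k + 1)) = (i : ℝ) + 1 + -(k / (k + 1)) by ring,
      eq_div_iff h3, add_mul, div_mul_cancel₀ _ h3]
    ring
  rw [h0, h0, h1, h2, ← Finset.prod_range_mul_prod_Ico _ hjn]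
  have h3 : ∏ i ∈ Finset.range j, ((i : ℝ) + 1 + -(k / (k + 1))) ≠ 0 :=
    Finset.prod_ne_zero_iff.2 fun i _ => (hpos i).ne'
  have h4 : ∏ i ∈ Finset.Ico j n, ((i : ℝ) + 1 + -(k / (k + 1))) ≠ 0 :=
    Finset.prod_ne_zero_iff.2 fun i _ => (hpos i).ne'
  have h5 : (n.choose j : ℝ) * j.factorial * (n - j).factorial = n.factorial := by
    exact_mod_cast Nat.choose_mul_factorial_mul_factorial hjn
  have h6 : (n.choose j : ℝ) ≠ 0 := Nat.cast_ne_zero.2 (Nat.choose_pos hjn).ne'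
  have h7 : (j.factorial : ℝ) ≠ 0 := Nat.cast_ne_zero.2 j.factorial_ne_zero
  have h8 : ((n - j).factorial : ℝ) ≠ 0 := Nat.cast_ne_zero.2 (n - j).factorial_ne_zero
  generalize ∏ i ∈ Finset.range j, ((i : ℝ) + 1 + -(k / (k + 1))) = A at h3 ⊢
  generalize ∏ i ∈ Finset.Ico j n, ((i : ℝ) + 1 + -(k / (k + 1))) = B at h4 ⊢
  generalize ∏ i ∈ Finset.Ico j n, ((i : ℝ) + 1 + -(k * (2 + l) / (k + 1))) = D
  rw [← h5]
  field_simp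

/-- The rising factorial moments, for which the moment recursion closes. -/
lemma integral_ascFactorial_outDegree (hk : 1 ≤ k) {j n : ℕ} (hj : 1 ≤ j) (hjn : j ≤ n) (s : ℕ) :
    ∫ T, ((T.outDegree j + 1).ascFactorial s : ℝ) ∂randomKTree k n =
      s.factorial * ∏ i ∈ Finset.Ico j n,
        (1 + k / (k + 1) * s / ((i : ℝ) + (1 - k / (k + 1)))) := by
  induction n, hjn using Nat.le_induction with
  | base =>
    rw [integral_outDegree_self hj fun d => ((d + 1).ascFactorial s : ℝ)]
    simp [Nat.one_ascFactorial]
  | succ n hjn ih =>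
    rw [integral_outDegree_succ hk hj hjn fun d => ((d + 1).ascFactorial s : ℝ),
      Finset.prod_Ico_succ_top hjn, ← mul_assoc, ← ih, ← integral_mul_const]
    congr 1
    funext T
    have h := congrArg (Nat.cast (R := ℝ)) (Nat.succ_ascFactorial (T.outDegree j + 1) s)
    push_cast at h
    rw [Nat.succ_eq_add_one] at h
    rw [add_sub_assoc]
    linear_combination k / (k + 1) / ((n : ℝ) + (1 - k / (k + 1))) * h

/-- If the scaled rising factorial moments converge and the scale tends to zero, then the scaled
moments converge to the same limits. -/
lemma tendsto_integral_pow_of_ascFactorial {j : ℕ → ℕ} {c : ℕ → ℝ} {μ : ℕ → ℝ}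
    (hc : Tendsto c atTop (𝓝 0))
    (h : ∀ s, Tendsto (fun n => c n ^ s *
      ∫ T, ((T.outDegree (j n) + 1).ascFactorial s : ℝ) ∂randomKTree k n) atTop (𝓝 (μ s)))
    (s : ℕ) :
    Tendsto (fun n => ∫ T, (c n * (T.outDegree (j n) : ℝ)) ^ s ∂randomKTree k n) atTop
      (𝓝 (μ s)) := by
  -- the mixed moments `X ^ s (X + 1) ⋯ (X + r)` allow for an induction on `s`
  have key : ∀ s r, Tendsto (fun n => c n ^ (s + r) * ∫ T, (T.outDegree (j n) : ℝ) ^ s *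
      ((T.outDegree (j n) + 1).ascFactorial r : ℝ) ∂randomKTree k n) atTop (𝓝 (μ (s + r))) := by
    intro s
    induction s with
    | zero => intro r; simpa using h r
    | succ s ih =>
      intro r
      have h1 := (ih (r + 1)).sub ((hc.mul (ih r)).const_mul ((r : ℝ) + 1))
      rw [zero_mul, mul_zero, sub_zero, show s + (r + 1) = s + 1 + r by ring] at h1
      refine h1.congr fun n => ?_
      have h2 : ∀ T : OrderedIncreasingKTree k n, (T.outDegree (j n) : ℝ) ^ (s + 1) *
          ((T.outDegree (j n) + 1).ascFactorial r : ℝ) =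
          (T.outDegree (j n) : ℝ) ^ s * ((T.outDegree (j n) + 1).ascFactorial (r + 1) : ℝ) -
          (r + 1) * ((T.outDegree (j n) : ℝ) ^ s *
            ((T.outDegree (j n) + 1).ascFactorial r : ℝ)) := by
        intro T
        rw [Nat.ascFactorial_succ]
        push_cast
        ring
      simp only [h2]
      rw [integral_sub Integrable.of_finite Integrable.of_finite, integral_const_mul]
      ring
  have := key s 0
  simp only [Nat.ascFactorial_zero, Nat.cast_one, mul_one, add_zero] at this
  refine this.congr fun n => ?_
  rw [← integral_const_mul]
  simp only [mul_pow]

/-! ### Limits of the exact expressions -/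

/-- When `j n / n` has a positive limit, the point probabilities converge to those of a geometric
distribution. The limit `ρ = 1` is allowed, and gives a point mass at `0`. -/
lemma tendsto_randomKTree_real_outDegree_eq (hk : 1 ≤ k) {j : ℕ → ℕ} {ρ : ℝ} (hρ : 0 < ρ)
    (hj : Tendsto j atTop atTop) (hjn : ∀ᶠ n in atTop, j n ≤ n)
    (hlim : Tendsto (fun n => (j n : ℝ) / n) atTop (𝓝 ρ)) (m : ℕ) :
    Tendsto (fun n => (randomKTree k n).real {T | T.outDegree (j n) = m}) atTop
      (𝓝 (ρ ^ ((k : ℝ) / (k + 1)) * (1 - ρ ^ ((k : ℝ) / (k + 1))) ^ m)) := by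
  have hb : (0 : ℝ) < 1 - k / (k + 1) := by
    rw [sub_pos, div_lt_one (by positivity)]
    linarith
  have hprod : ∀ c : ℝ, Tendsto (fun n => ∏ i ∈ Finset.Ico (j n) n,
      (1 + -c / ((i : ℝ) + (1 - k / (k + 1))))) atTop (𝓝 (ρ ^ c)) := by
    intro c
    have h1 := (tendsto_div_rpow_mul_prod_one_add_div (-c) hb hj hjn).div
      (hlim.rpow_const (p := -c) (Or.inl hρ.ne')) (Real.rpow_pos_of_pos hρ _).ne'
    rw [Real.rpow_neg hρ.le, one_div, inv_inv] at h1
    refine h1.congr' ?_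
    filter_upwards [hlim.eventually_const_lt hρ] with n hn
    exact mul_div_cancel_left₀ _ (Real.rpow_pos_of_pos hn (-c)).ne'
  have hsum : ρ ^ ((k : ℝ) / (k + 1)) * (1 - ρ ^ ((k : ℝ) / (k + 1))) ^ m =
      ∑ l ∈ Finset.range (m + 1), (m.choose l : ℝ) * (-1) ^ l *
        ρ ^ ((k : ℝ) / (k + 1) * (l + 1)) := by
    rw [sub_eq_neg_add, add_pow, Finset.mul_sum]
    refine Finset.sum_congr rfl fun l _ => ?_
    rw [Real.rpow_mul hρ.le, ← Nat.cast_add_one l, Real.rpow_natCast,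
      neg_pow (ρ ^ _), one_pow]
    ring
  rw [hsum]
  have h2 : Tendsto (fun n => ∑ l ∈ Finset.range (m + 1), (m.choose l : ℝ) * (-1) ^ l *
        ∏ i ∈ Finset.Ico (j n) n,
          (1 + -(k / (k + 1) * ((l : ℝ) + 1)) / ((i : ℝ) + (1 - k / (k + 1))))) atTop
      (𝓝 (∑ l ∈ Finset.range (m + 1), (m.choose l : ℝ) * (-1) ^ l *
        ρ ^ ((k : ℝ) / (k + 1) * (l + 1)))) :=
    tendsto_finsetSum _ fun l _ => (hprod _).const_mul _
  refine h2.congr' ?_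
  filter_upwards [hjn, hj.eventually_ge_atTop 1] with n h3 h4
  rw [randomKTree_real_outDegree_eq hk h4 h3]

/-- Moments for fixed `j`, in the scale `n ^ (k / (k + 1))`. -/
lemma tendsto_integral_pow_of_fixed (hk : 1 ≤ k) {j : ℕ} (hj : 1 ≤ j) (s : ℕ) :
    Tendsto (fun n : ℕ => ∫ T, ((n : ℝ) ^ (-((k : ℝ) / (k + 1))) * (T.outDegree j : ℝ)) ^ s
      ∂randomKTree k n) atTop
      (𝓝 ((s.factorial : ℝ) * Real.Gamma ((j : ℝ) + 1 / (k + 1))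
        / Real.Gamma ((j : ℝ) + 1 + k * ((s : ℝ) - 1) / (k + 1)))) := by
  have hk0 : (0 : ℝ) < k := Nat.cast_pos.2 hk
  have hb : (0 : ℝ) < 1 - k / (k + 1) := by
    rw [sub_pos, div_lt_one (by positivity)]
    linarith
  refine tendsto_integral_pow_of_ascFactorial (j := fun _ => j)
    (c := fun n : ℕ => (n : ℝ) ^ (-((k : ℝ) / (k + 1))))
    (μ := fun s : ℕ => (s.factorial : ℝ) * Real.Gamma ((j : ℝ) + 1 / (k + 1))
        / Real.Gamma ((j : ℝ) + 1 + k * ((s : ℝ) - 1) / (k + 1)))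
    ((tendsto_rpow_neg_atTop (by positivity)).comp tendsto_natCast_atTop_atTop) (fun s => ?_) s
  have h1 := (tendsto_rpow_mul_prod_one_add_div (b := 1 - k / (k + 1)) (c := k / (k + 1) * s)
    (j := j) hb (by positivity)).const_mul (s.factorial : ℝ)
  rw [← mul_div_assoc, show (j : ℝ) + (1 - k / (k + 1)) = j + 1 / (k + 1) by field_simp; ring,
    show (j : ℝ) + 1 / (k + 1) + k / (k + 1) * s = j + 1 + k * (s - 1) / (k + 1) by
      field_simp; ring] at h1
  refine h1.congr' ?_
  filter_upwards [eventually_ge_atTop j] with n hn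
  rw [integral_ascFactorial_outDegree hk hj hn, ← Real.rpow_natCast,
    ← Real.rpow_mul (by positivity), neg_mul]
  ring

/-- Moments for `j → ∞` with `j = o(n)`, in the scale `(n / j) ^ (k / (k + 1))`. -/
lemma tendsto_integral_pow_of_isLittleO (hk : 1 ≤ k) {j : ℕ → ℕ} (hj : Tendsto j atTop atTop)
    (hjn : (fun n : ℕ => (j n : ℝ)) =o[atTop] (fun n : ℕ => (n : ℝ))) (s : ℕ) :
    Tendsto (fun n : ℕ => ∫ T, (((j n : ℝ) / n) ^ ((k : ℝ) / (k + 1)) *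
      (T.outDegree (j n) : ℝ)) ^ s ∂randomKTree k n) atTop (𝓝 (s.factorial : ℝ)) := by
  have hk0 : (0 : ℝ) < k := Nat.cast_pos.2 hk
  have hb : (0 : ℝ) < 1 - k / (k + 1) := by
    rw [sub_pos, div_lt_one (by positivity)]
    linarith
  have hle : ∀ᶠ n in atTop, j n ≤ n := by
    filter_upwards [hjn.bound one_pos] with n hn
    simpa using hn
  have hc : Tendsto (fun n : ℕ => ((j n : ℝ) / n) ^ ((k : ℝ) / (k + 1))) atTop (𝓝 0) := by
    have := hjn.tendsto_div_nhds_zero.rpow_const (p := (k : ℝ) / (k + 1))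
      (Or.inr (by positivity))
    rwa [Real.zero_rpow (by positivity)] at this
  refine tendsto_integral_pow_of_ascFactorial (μ := fun s : ℕ => (s.factorial : ℝ)) hc
    (fun s => ?_) s
  have h1 := (tendsto_div_rpow_mul_prod_one_add_div (b := 1 - k / (k + 1)) (k / (k + 1) * s)
    hb hj hle).const_mul (s.factorial : ℝ)
  rw [mul_one] at h1
  refine h1.congr' ?_
  filter_upwards [hle, hj.eventually_ge_atTop 1] with n hn hn1
  rw [integral_ascFactorial_outDegree hk hn1 hn, ← Real.rpow_natCast,
    ← Real.rpow_mul (by positivity)]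
  ring

end OrderedIncreasingKTree

/-! ### The method of moments -/

/-- Moments of at most factorial growth give a moment generating function near zero. -/
lemma zero_mem_interior_integrableExpSet {ν : Measure ℝ} [IsProbabilityMeasure ν] {C : ℝ}
    (hint : ∀ s : ℕ, Integrable (fun x : ℝ => x ^ s) ν)
    (hC : ∀ s : ℕ, ∫ x, x ^ s ∂ν ≤ C * s.factorial) :
    (0 : ℝ) ∈ interior (integrableExpSet (id : ℝ → ℝ) ν) := by
  have hcosh : Integrable (fun x : ℝ => Real.cosh (x / 2)) ν := by
    refine ⟨(Real.continuous_cosh.comp (continuous_id.div_const 2)).aestronglyMeasurable, ?_⟩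
    rw [hasFiniteIntegral_iff_ofReal (ae_of_all _ fun x => (Real.cosh_pos _).le)]
    have hterm : ∀ (n : ℕ) (x : ℝ), 0 ≤ (x / 2) ^ (2 * n) / ((2 * n).factorial : ℝ) := fun n x => by
      rw [pow_mul]; positivity
    have h1 : ∀ x : ℝ, ENNReal.ofReal (Real.cosh (x / 2)) =
        ∑' n : ℕ, ENNReal.ofReal ((x / 2) ^ (2 * n) / ((2 * n).factorial : ℝ)) := fun x => by
      rw [← ENNReal.ofReal_tsum_of_nonneg (fun n => hterm n x) (Real.hasSum_cosh _).summable,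
        Real.cosh_eq_tsum]
    simp only [h1]
    rw [lintegral_tsum fun n => (Continuous.measurable (by fun_prop)).ennreal_ofReal.aemeasurable]
    have h2 : ∀ n : ℕ, ∫⁻ x, ENNReal.ofReal ((x / 2) ^ (2 * n) / ((2 * n).factorial : ℝ)) ∂ν ≤
        ENNReal.ofReal (C * (1 / 4) ^ n) := by
      intro n
      have hfun : (fun x : ℝ => (x / 2) ^ (2 * n) / ((2 * n).factorial : ℝ)) =
          fun x => ((1 / 4) ^ n / ((2 * n).factorial : ℝ)) * x ^ (2 * n) := by
        funext x
        rw [div_pow, pow_mul 2 2 n, one_div, inv_pow]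
        norm_num
        ring
      rw [← ofReal_integral_eq_lintegral_ofReal (by rw [hfun]; exact (hint _).const_mul _)
        (ae_of_all _ fun x => hterm n x), hfun, integral_const_mul]
      refine ENNReal.ofReal_le_ofReal ?_
      calc (1 / 4 : ℝ) ^ n / ((2 * n).factorial : ℝ) * ∫ x, x ^ (2 * n) ∂ν
          ≤ (1 / 4 : ℝ) ^ n / ((2 * n).factorial : ℝ) * (C * (2 * n).factorial) := by
            gcongr
            exact hC _
        _ = C * (1 / 4) ^ n := by
            have : ((2 * n).factorial : ℝ) ≠ 0 := Nat.cast_ne_zero.2 (Nat.factorial_ne_zero _)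
            field_simp
    have hC0 : 0 ≤ C := by
      have := hC 0
      simp at this
      linarith
    refine (ENNReal.tsum_le_tsum h2).trans_lt ?_
    rw [← ENNReal.ofReal_tsum_of_nonneg (fun n => by positivity)
      ((summable_geometric_of_lt_one (by norm_num) (by norm_num)).mul_left C)]
    exact ENNReal.ofReal_lt_top
  have hexp : ∀ t : ℝ, t = 1 / 2 ∨ t = -(1 / 2) → t ∈ integrableExpSet (id : ℝ → ℝ) ν := by
    intro t ht
    refine (hcosh.const_mul 2).mono' (Continuous.aestronglyMeasurable (by fun_prop))
      (ae_of_all _ fun x => ?_)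
    rw [Real.norm_eq_abs, abs_of_pos (Real.exp_pos _), Real.cosh_eq]
    have h1 := Real.exp_pos (x / 2)
    have h2 := Real.exp_pos (-(x / 2))
    rcases ht with rfl | rfl
    · rw [show 1 / 2 * id x = x / 2 by simp; ring]; linarith
    · rw [show -(1 / 2) * id x = -(x / 2) by simp; ring]; linarith
  have hsub : Set.Icc (-(1 / 2) : ℝ) (1 / 2) ⊆ integrableExpSet (id : ℝ → ℝ) ν :=
    convex_integrableExpSet.ordConnected.out (hexp _ (Or.inr rfl)) (hexp _ (Or.inl rfl))
  exact mem_interior_iff_mem_nhds.2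
    (mem_of_superset (Icc_mem_nhds (by norm_num) (by norm_num)) hsub)

/-- A law on the line whose moments grow at most like factorials is determined by them: the moments
are the Taylor coefficients at zero of the complex moment generating function, which is analytic in
a vertical strip containing the imaginary axis. -/
lemma MeasureTheory.Measure.eq_of_moments {ν ν' : Measure ℝ} [IsProbabilityMeasure ν]
    [IsProbabilityMeasure ν'] {C : ℝ} (hint : ∀ s : ℕ, Integrable (fun x : ℝ => x ^ s) ν)
    (hC : ∀ s : ℕ, ∫ x, x ^ s ∂ν ≤ C * s.factorial)
    (hint' : ∀ s : ℕ, Integrable (fun x : ℝ => x ^ s) ν')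
    (heq : ∀ s : ℕ, ∫ x, x ^ s ∂ν' = ∫ x, x ^ s ∂ν) : ν' = ν := by
  have h0 := zero_mem_interior_integrableExpSet hint hC
  have h0' := zero_mem_interior_integrableExpSet hint' fun s => (heq s).trans_le (hC s)
  have hderiv : ∀ n, iteratedDeriv n (complexMGF id ν') 0 =
      iteratedDeriv n (complexMGF id ν) 0 := by
    intro n
    rw [iteratedDeriv_complexMGF (by simpa using h0') n,
      iteratedDeriv_complexMGF (by simpa using h0) n]
    have h := congrArg (Complex.ofReal) (heq n)
    rw [← integral_complex_ofReal, ← integral_complex_ofReal] at h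
    simpa using h
  have hp := (analyticAt_complexMGF (z := 0) (by simpa using h0)).hasFPowerSeriesAt
  have hp' := (analyticAt_complexMGF (z := 0) (by simpa using h0')).hasFPowerSeriesAt
  simp only [hderiv] at hp'
  have hev : complexMGF id ν' =ᶠ[𝓝 0] complexMGF id ν := by
    filter_upwards [hp.eventually_hasSum_sub, hp'.eventually_hasSum_sub] with z h1 h2
    exact h2.unique h1
  set S := interior (integrableExpSet (id : ℝ → ℝ) ν') ∩ interior (integrableExpSet (id : ℝ → ℝ) ν)
  have hS : Convex ℝ S := convex_integrableExpSet.interior.inter convex_integrableExpSet.interior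
  have hEq : Set.EqOn (complexMGF id ν') (complexMGF id ν) {z | z.re ∈ S} :=
    AnalyticOnNhd.eqOn_of_preconnected_of_eventuallyEq
      (analyticOnNhd_complexMGF.mono fun z hz => hz.1)
      (analyticOnNhd_complexMGF.mono fun z hz => hz.2)
      (hS.linear_preimage Complex.reLm).isPreconnected (z₀ := 0)
      ⟨by simpa using h0', by simpa using h0⟩ hev
  refine Measure.ext_of_charFun (funext fun t => ?_)
  rw [← complexMGF_id_mul_I, ← complexMGF_id_mul_I]
  exact hEq ⟨by simpa using h0', by simpa using h0⟩

lemma integrable_pow_of_even {ν : Measure ℝ} [IsFiniteMeasure ν] {s : ℕ}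
    (h : Integrable (fun x : ℝ => (x ^ s) ^ 2) ν) : Integrable (fun x : ℝ => x ^ s) ν := by
  refine ((integrable_const (1 : ℝ)).add h).mono' (Continuous.aestronglyMeasurable (by fun_prop))
    (ae_of_all _ fun x => ?_)
  simp only [Pi.add_apply, Real.norm_eq_abs]
  nlinarith [sq_nonneg (|x ^ s| - 1), sq_abs (x ^ s), abs_nonneg (x ^ s)]

/-- The truncation of `x ^ s` at the levels `± M`. -/
noncomputable def truncPow (s : ℕ) (M : ℝ) : BoundedContinuousFunction ℝ ℝ :=
  BoundedContinuousFunction.ofNormedAddCommGroup (fun x => max (-M) (min (x ^ s) M))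
    (by fun_prop) |M| fun x => by
      rw [Real.norm_eq_abs, abs_le]
      have h1 := neg_abs_le M
      have h2 := le_abs_self M
      have h3 := neg_le_abs M
      exact ⟨le_max_of_le_left (by linarith),
        max_le h3 ((min_le_right _ _).trans h2)⟩

lemma truncPow_apply (s : ℕ) (M x : ℝ) : truncPow s M x = max (-M) (min (x ^ s) M) := rfl

lemma abs_integral_sub_integral_truncPow_le {ν : Measure ℝ} [IsProbabilityMeasure ν] {s : ℕ}
    {M : ℝ} (hM : 0 < M) (h : Integrable (fun x : ℝ => (x ^ s) ^ 2) ν) :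
    |∫ x, x ^ s ∂ν - ∫ x, truncPow s M x ∂ν| ≤ (∫ x, (x ^ s) ^ 2 ∂ν) / M := by
  rw [← integral_sub (integrable_pow_of_even h) ((truncPow s M).integrable ν), ← integral_div]
  refine (abs_integral_le_integral_abs).trans (integral_mono_of_nonneg
    (ae_of_all _ fun x => abs_nonneg _) (h.div_const M) (ae_of_all _ fun x => ?_))
  simp only [truncPow_apply]
  generalize x ^ s = y
  rw [le_div_iff₀ hM]
  rcases le_total y M with h1 | h1
  · rw [min_eq_left h1]
    rcases le_total (-M) y with h2 | h2
    · rw [max_eq_right h2, sub_self, abs_zero, zero_mul]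
      positivity
    · rw [max_eq_left h2, abs_of_nonpos (by linarith)]
      nlinarith
  · rw [min_eq_right h1, max_eq_right (by linarith), abs_of_nonneg (by linarith)]
    nlinarith

/-- If laws converge weakly and all their moments converge, then the limits of the moments are the
moments of the limit law. -/
lemma moments_of_tendsto {ι : Type*} {L : Filter ι} [L.NeBot] {μs : ι → ProbabilityMeasure ℝ}
    {ν : ProbabilityMeasure ℝ} {m : ℕ → ℝ} (hν : Tendsto μs L (𝓝 ν))
    (hint : ∀ i (s : ℕ), Integrable (fun x : ℝ => x ^ s) (μs i : Measure ℝ))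
    (hm : ∀ s : ℕ, Tendsto (fun i => ∫ x, x ^ s ∂(μs i : Measure ℝ)) L (𝓝 (m s))) (s : ℕ) :
    Integrable (fun x : ℝ => x ^ s) (ν : Measure ℝ) ∧ ∫ x, x ^ s ∂(ν : Measure ℝ) = m s := by
  rw [ProbabilityMeasure.tendsto_iff_forall_integral_tendsto] at hν
  have hsq : (fun x : ℝ => (x ^ s) ^ 2) = fun x => x ^ (s * 2) := by
    funext x; rw [pow_mul]
  -- the second moment of `x ^ s` under `ν` is bounded by truncation and monotone convergence
  have hbound : ∀ M : ℝ, 0 ≤ M → ∫ x, truncPow (s * 2) M x ∂(ν : Measure ℝ) ≤ m (s * 2) := by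
    intro M hM
    refine le_of_tendsto_of_tendsto (hν _) (hm (s * 2)) (Eventually.of_forall fun i => ?_)
    refine integral_mono ((truncPow _ M).integrable _) (hint i _) fun x => ?_
    rw [truncPow_apply]
    have : 0 ≤ x ^ (s * 2) := by rw [pow_mul]; positivity
    exact max_le (by linarith) (min_le_left _ _)
  have hlint : ∫⁻ x, ENNReal.ofReal (x ^ (s * 2)) ∂(ν : Measure ℝ) ≤
      ENNReal.ofReal (m (s * 2)) := by
    have hnn : ∀ (n : ℕ) (x : ℝ), 0 ≤ truncPow (s * 2) n x := fun n x => by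
      rw [truncPow_apply]
      have : 0 ≤ x ^ (s * 2) := by rw [pow_mul]; positivity
      exact le_max_of_le_right (le_min this n.cast_nonneg)
    refine le_of_tendsto' (lintegral_tendsto_of_tendsto_of_monotone
      (f := fun (n : ℕ) x => ENNReal.ofReal (truncPow (s * 2) n x))
      (fun n => (truncPow _ _).continuous.measurable.ennreal_ofReal.aemeasurable)
      (ae_of_all _ fun x a b hab => ENNReal.ofReal_le_ofReal ?_)
      (ae_of_all _ fun x => tendsto_const_nhds.congr' ?_)) fun n => ?_
    · have hab' : (a : ℝ) ≤ b := Nat.cast_le.2 hab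
      have : 0 ≤ x ^ (s * 2) := by rw [pow_mul]; positivity
      have ha : (0 : ℝ) ≤ a := a.cast_nonneg
      simp only [truncPow_apply]
      rw [max_eq_right, max_eq_right]
      · exact min_le_min le_rfl hab'
      · exact le_min (by linarith) (by linarith)
      · exact le_min (by linarith) (by linarith)
    · filter_upwards [tendsto_natCast_atTop_atTop.eventually_ge_atTop (x ^ (s * 2))] with n hn
      have : 0 ≤ x ^ (s * 2) := by rw [pow_mul]; positivity
      rw [truncPow_apply, min_eq_left hn, max_eq_right (by linarith)]
    · rw [← ofReal_integral_eq_lintegral_ofReal ((truncPow _ _).integrable _)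
        (ae_of_all _ fun x => hnn n x)]
      exact ENNReal.ofReal_le_ofReal (hbound n n.cast_nonneg)
  have hsqint : Integrable (fun x : ℝ => (x ^ s) ^ 2) (ν : Measure ℝ) := by
    rw [hsq]
    refine ⟨Continuous.aestronglyMeasurable (by fun_prop), ?_⟩
    rw [hasFiniteIntegral_iff_ofReal (ae_of_all _ fun x => by
      show 0 ≤ x ^ (s * 2); rw [pow_mul]; positivity)]
    exact hlint.trans_lt ENNReal.ofReal_lt_top
  have hnonneg : 0 ≤ m (s * 2) :=
    ge_of_tendsto' (hm (s * 2)) fun i => integral_nonneg fun x => by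
      show 0 ≤ x ^ (s * 2); rw [pow_mul]; positivity
  have hle : ∫ x, (x ^ s) ^ 2 ∂(ν : Measure ℝ) ≤ m (s * 2) := by
    rw [← ENNReal.ofReal_le_ofReal_iff hnonneg,
      ofReal_integral_eq_lintegral_ofReal hsqint (ae_of_all _ fun x => sq_nonneg _)]
    simpa only [pow_mul] using hlint
  refine ⟨integrable_pow_of_even hsqint, ?_⟩
  have hdist : ∀ n : ℕ, |∫ x, x ^ s ∂(ν : Measure ℝ) - m s| ≤ 2 * m (s * 2) / (n + 1) := by
    intro n
    have hn : (0 : ℝ) < n + 1 := by positivity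
    have h1 : |∫ x, x ^ s ∂(ν : Measure ℝ) - ∫ x, truncPow s (n + 1) x ∂(ν : Measure ℝ)| ≤
        m (s * 2) / (n + 1) :=
      (abs_integral_sub_integral_truncPow_le hn hsqint).trans (by gcongr)
    have h2 : |m s - ∫ x, truncPow s (n + 1) x ∂(ν : Measure ℝ)| ≤ m (s * 2) / (n + 1) := by
      refine le_of_tendsto_of_tendsto ((hm s).sub (hν (truncPow s (n + 1)))).abs
        ((hm (s * 2)).div_const _) (Eventually.of_forall fun i => ?_)
      have := abs_integral_sub_integral_truncPow_le (ν := (μs i : Measure ℝ)) (s := s) hn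
        (by rw [hsq]; exact hint i _)
      rwa [hsq] at this
    have h3 := abs_sub_le (∫ x, x ^ s ∂(ν : Measure ℝ))
      (∫ x, truncPow s (n + 1) x ∂(ν : Measure ℝ)) (m s)
    rw [abs_sub_comm (m s)] at h2
    rw [two_mul, add_div]
    linarith
  have hlim : Tendsto (fun n : ℕ => 2 * m (s * 2) / ((n : ℝ) + 1)) atTop (𝓝 0) :=
    tendsto_const_nhds.div_atTop (tendsto_atTop_add_const_right _ _ tendsto_natCast_atTop_atTop)
  have := ge_of_tendsto' hlim hdist
  exact sub_eq_zero.1 (abs_eq_zero.1 (le_antisymm this (abs_nonneg _)))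

/-- Bounded second moments imply tightness. -/
lemma isCompact_closure_range_of_sq_le {ι : Type*} {μs : ι → ProbabilityMeasure ℝ} {B : ℝ}
    (hint : ∀ i, Integrable (fun x : ℝ => x ^ 2) (μs i : Measure ℝ))
    (hB : ∀ i, ∫ x, x ^ 2 ∂(μs i : Measure ℝ) ≤ B) :
    IsCompact (closure (Set.range μs)) := by
  refine isCompact_closure_of_isTightMeasureSet ?_
  rw [isTightMeasureSet_iff_exists_isCompact_measure_compl_le]
  intro ε hε
  obtain ⟨δ, hδ, hδε⟩ := ENNReal.lt_iff_exists_nnreal_btwn.1 hε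
  have hδ' : (0 : ℝ) < δ := by exact_mod_cast hδ
  set r : ℝ := Real.sqrt (|B| / δ + 1)
  have hr2 : r ^ 2 = |B| / δ + 1 := Real.sq_sqrt (by positivity)
  refine ⟨Metric.closedBall 0 r, isCompact_closedBall 0 r, ?_⟩
  rintro _ ⟨_, ⟨i, rfl⟩, rfl⟩
  refine le_trans ?_ hδε.le
  have hmarkov := mul_meas_ge_le_integral_of_nonneg (ae_of_all _ fun x => sq_nonneg x) (hint i)
    (r ^ 2)
  have hsub : (Metric.closedBall (0 : ℝ) r)ᶜ ⊆ {x : ℝ | r ^ 2 ≤ x ^ 2} := by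
    intro x hx
    have hx : r < |x| := by simpa using hx
    show r ^ 2 ≤ x ^ 2
    rw [← sq_abs x]
    exact pow_le_pow_left₀ (Real.sqrt_nonneg _) hx.le 2
  have hreal : (μs i : Measure ℝ).real {x : ℝ | r ^ 2 ≤ x ^ 2} ≤ δ := by
    have h1 := hmarkov.trans ((hB i).trans (le_abs_self B))
    rw [hr2] at h1 ⊢
    by_contra! hcon
    have h2 : (|B| / δ + 1) * δ < |B| := lt_of_lt_of_le (by gcongr) h1
    rw [add_mul, div_mul_cancel₀ _ hδ'.ne'] at h2
    linarith
  refine (measure_mono hsub).trans ?_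
  rw [← ENNReal.ofReal_coe_nnreal]
  exact (ENNReal.le_ofReal_iff_toReal_le (measure_ne_top _ _) hδ'.le).2 hreal

/-- The method of moments: convergence of all moments, to limits of at most factorial growth, implies
weak convergence to a law with these moments. -/
theorem exists_tendsto_of_tendsto_moments {μs : ℕ → ProbabilityMeasure ℝ} {m : ℕ → ℝ} {C : ℝ}
    (hint : ∀ i (s : ℕ), Integrable (fun x : ℝ => x ^ s) (μs i : Measure ℝ))
    (hm : ∀ s : ℕ, Tendsto (fun i => ∫ x, x ^ s ∂(μs i : Measure ℝ)) atTop (𝓝 (m s)))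
    (hC : ∀ s : ℕ, m s ≤ C * s.factorial) :
    ∃ ν : ProbabilityMeasure ℝ, Tendsto μs atTop (𝓝 ν) ∧
      ∀ s : ℕ, Integrable (fun x : ℝ => x ^ s) (ν : Measure ℝ) ∧
        ∫ x, x ^ s ∂(ν : Measure ℝ) = m s := by
  obtain ⟨B, hB⟩ := (hm 2).bddAbove_range
  have hcomp := isCompact_closure_range_of_sq_le (fun i => hint i 2) fun i => hB ⟨i, rfl⟩
  have hmem : ∀ i, μs i ∈ closure (Set.range μs) := fun i => subset_closure ⟨i, rfl⟩
  have hclus : ∀ ν, MapClusterPt ν atTop μs → ∀ s : ℕ,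
      Integrable (fun x : ℝ => x ^ s) (ν : Measure ℝ) ∧ ∫ x, x ^ s ∂(ν : Measure ℝ) = m s := by
    intro ν hν s
    obtain ⟨U, hU, hUν⟩ := mapClusterPt_iff_ultrafilter.1 hν
    exact moments_of_tendsto hUν hint (fun s => (hm s).mono_left hU) s
  obtain ⟨ν, -, hν⟩ := hcomp.exists_mapClusterPt (f := atTop) (u := μs)
    (le_principal_iff.2 (Filter.mem_map.2 (Eventually.of_forall hmem)))
  refine ⟨ν, hcomp.tendsto_nhds_of_unique_mapClusterPt (Eventually.of_forall hmem)
    fun ν' _ hν' => ?_, hclus ν hν⟩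
  have heq : (ν' : Measure ℝ) = ν := Measure.eq_of_moments (fun s => (hclus ν hν s).1)
    (fun s => (hclus ν hν s).2.trans_le (hC s)) (fun s => (hclus ν' hν' s).1)
    fun s => (hclus ν' hν' s).2.trans (hclus ν hν s).2.symm
  exact Subtype.ext heq

/-- On `ℕ`, convergence of the point probabilities to those of a probability measure implies weak
convergence. -/
lemma MeasureTheory.ProbabilityMeasure.tendsto_of_tendsto_singleton {μs : ℕ → ProbabilityMeasure ℕ}
    {ν : ProbabilityMeasure ℕ}
    (h : ∀ m, Tendsto (fun n => (μs n : Measure ℕ).real {m}) atTop (𝓝 ((ν : Measure ℕ).real {m}))) :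
    Tendsto μs atTop (𝓝 ν) := by
  refine IsPiSystem.tendsto_probabilityMeasure_of_tendsto_of_mem
    (S := {s : Set ℕ | s.Subsingleton}) (fun s hs t _ _ => hs.anti Set.inter_subset_left)
    (fun _ _ => MeasurableSet.of_discrete)
    (fun u _ x hx => ⟨{x}, Set.subsingleton_singleton, by simp, by simpa using hx⟩)
    fun s hs => ?_
  rcases Set.Subsingleton.eq_empty_or_singleton hs with rfl | ⟨m, rfl⟩
  · simp
  · exact NNReal.tendsto_coe.1 (h m)

lemma expMeasure_one_moments (s : ℕ) :
    Integrable (fun x : ℝ => x ^ s) (expMeasure 1) ∧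
      ∫ x, x ^ s ∂(expMeasure 1) = (s.factorial : ℝ) := by
  have hpdf : ∀ x : ℝ, (gammaPDF 1 1 x).toReal =
      (Set.Ici (0 : ℝ)).indicator (fun x => Real.exp (-x)) x := by
    intro x
    rw [gammaPDF, ENNReal.toReal_ofReal (gammaPDFReal_nonneg one_pos one_pos x), gammaPDFReal]
    by_cases hx : 0 ≤ x <;> simp [hx]
  have hmeas : Measurable (gammaPDF 1 1) := (measurable_gammaPDFReal 1 1).ennreal_ofReal
  have hlt : ∀ᵐ x ∂(volume : Measure ℝ), gammaPDF 1 1 x < ⊤ :=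
    ae_of_all _ fun x => ENNReal.ofReal_lt_top
  have hprod : (fun x : ℝ => (gammaPDF 1 1 x).toReal • x ^ s) =
      (Set.Ici (0 : ℝ)).indicator fun x => Real.exp (-x) * x ^ (((s : ℝ) + 1) - 1) := by
    funext x
    rw [hpdf]
    by_cases hx : 0 ≤ x <;> simp [hx]
  have hs : (0 : ℝ) < (s : ℝ) + 1 := by positivity
  constructor
  · rw [expMeasure, gammaMeasure, integrable_withDensity_iff_integrable_smul' hmeas hlt, hprod,
      integrable_indicator_iff measurableSet_Ici, integrableOn_Ici_iff_integrableOn_Ioi]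
    exact Real.GammaIntegral_convergent hs
  · rw [expMeasure, gammaMeasure, integral_withDensity_eq_integral_toReal_smul hmeas hlt, hprod,
      integral_indicator measurableSet_Ici, integral_Ici_eq_integral_Ioi,
      ← Real.Gamma_eq_integral hs, Real.Gamma_nat_eq_factorial]

/-! ### The limit laws -/

/-- The factorial growth of the limiting moments for fixed `j`; it holds since `1 ≤ Γ` on
`[2, ∞)`. -/
lemma factorial_mul_Gamma_div_Gamma_le {k j : ℕ} (hj : 1 ≤ j) (s : ℕ) :
    (s.factorial : ℝ) * Real.Gamma ((j : ℝ) + 1 / (k + 1))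
        / Real.Gamma ((j : ℝ) + 1 + k * ((s : ℝ) - 1) / (k + 1)) ≤
      max 1 (Real.Gamma ((j : ℝ) + 1 / (k + 1))) * s.factorial := by
  have hΓ : 0 < Real.Gamma ((j : ℝ) + 1 / (k + 1)) := Real.Gamma_pos_of_pos (by positivity)
  rcases Nat.eq_zero_or_pos s with rfl | hs
  · have : (j : ℝ) + 1 + k * (((0 : ℕ) : ℝ) - 1) / (k + 1) = j + 1 / (k + 1) := by
      push_cast
      field_simp
      ring
    rw [this, Nat.factorial_zero, Nat.cast_one, one_mul, div_self hΓ.ne', mul_one]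
    exact le_max_left _ _
  · have hj' : (1 : ℝ) ≤ j := Nat.one_le_cast.2 hj
    have hs' : (0 : ℝ) ≤ (s : ℝ) - 1 := sub_nonneg.2 (Nat.one_le_cast.2 hs)
    have h2 : (2 : ℝ) ≤ (j : ℝ) + 1 + k * ((s : ℝ) - 1) / (k + 1) := by
      have : 0 ≤ k * ((s : ℝ) - 1) / (k + 1) := by positivity
      linarith
    have h1 : 1 ≤ Real.Gamma ((j : ℝ) + 1 + k * ((s : ℝ) - 1) / (k + 1)) := by
      have := Real.Gamma_strictMonoOn_Ici.monotoneOn Set.self_mem_Ici h2 h2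
      rwa [Real.Gamma_two] at this
    refine (div_le_self (by positivity) h1).trans ?_
    rw [mul_comm]
    gcongr
    exact le_max_right _ _

namespace OrderedIncreasingKTree

variable {k : ℕ}

/-- The method of moments for random variables on the spaces of random trees. -/
lemma exists_tendstoInDistribution (X : (n : ℕ) → OrderedIncreasingKTree k n → ℝ) {m : ℕ → ℝ}
    {C : ℝ}
    (hm : ∀ s : ℕ, Tendsto (fun n => ∫ T, X n T ^ s ∂randomKTree k n) atTop (𝓝 (m s)))
    (hC : ∀ s : ℕ, m s ≤ C * s.factorial) :
    ∃ (ν : Measure ℝ) (_ : IsProbabilityMeasure ν),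
      TendstoInDistribution X atTop (id : ℝ → ℝ) (fun n => randomKTree k n) ν ∧
        ∀ s : ℕ, Integrable (fun x : ℝ => x ^ s) ν ∧ ∫ x, x ^ s ∂ν = m s := by
  have hmeas : ∀ n, AEMeasurable (X n) (randomKTree k n) := fun n =>
    (measurable_from_top (f := X n)).aemeasurable
  have hpow : ∀ n (s : ℕ), AEStronglyMeasurable (fun x : ℝ => x ^ s)
      ((randomKTree k n).map (X n)) :=
    fun n s => Continuous.aestronglyMeasurable (by fun_prop)
  obtain ⟨ν, h1, h2⟩ := exists_tendsto_of_tendsto_moments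
    (μs := fun n => ⟨(randomKTree k n).map (X n), Measure.isProbabilityMeasure_map (hmeas n)⟩)
    (m := m) (C := C)
    (fun n s => (integrable_map_measure (hpow n s) (hmeas n)).2 Integrable.of_finite)
    (fun s => by
      refine (hm s).congr fun n => ?_
      exact (integral_map (hmeas n) (hpow n s)).symm) hC
  refine ⟨ν, inferInstance, ⟨hmeas, aemeasurable_id, ?_⟩, h2⟩
  have hid : (ν : Measure ℝ).map id = ν := Measure.map_id
  rwa [show (⟨(ν : Measure ℝ).map id, Measure.isProbabilityMeasure_map aemeasurable_id⟩ :
    ProbabilityMeasure ℝ) = ν from Subtype.ext hid]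

/-- Convergence of the point probabilities to those of a geometric law implies convergence in
distribution. -/
lemma tendstoInDistribution_geometric {j : ℕ → ℕ} {p : unitInterval}
    (hp : p ≠ 0)
    (h : ∀ m, Tendsto (fun n => (randomKTree k n).real {T | T.outDegree (j n) = m}) atTop
      (𝓝 ((p : ℝ) * (1 - p) ^ m))) :
    TendstoInDistribution (fun (n : ℕ) (T : OrderedIncreasingKTree k n) => T.outDegree (j n))
      atTop (id : ℕ → ℕ) (fun n => randomKTree k n) (geometricMeasure p) := by
  refine ⟨fun n => measurable_from_top.aemeasurable, aemeasurable_id,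
    ProbabilityMeasure.tendsto_of_tendsto_singleton fun m => ?_⟩
  have h1 : ((geometricMeasure p).map id).real {m} = (p : ℝ) * (1 - p) ^ m := by
    rw [Measure.map_id, geometricMeasure_real_singleton hp, mul_comm]
  have h2 : ∀ n, ((randomKTree k n).map fun T => T.outDegree (j n)).real {m} =
      (randomKTree k n).real {T | T.outDegree (j n) = m} := fun n => by
    rw [map_measureReal_apply measurable_from_top MeasurableSet.of_discrete]
    rfl
  show Tendsto (fun n => ((randomKTree k n).map fun T => T.outDegree (j n)).real {m}) atTop
    (𝓝 (((geometricMeasure p).map id).real {m}))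
  rw [h1]
  exact (h m).congr fun n => (h2 n).symm

end OrderedIncreasingKTree

theorem theorem1 (k : ℕ) (hk : 1 ≤ k) :
    -- exact distribution
    (∀ n j m : ℕ, 1 ≤ j → j ≤ n →
      (randomKTree k n).real {T | T.outDegree j = m} =
        Ring.choose ((j : ℝ) - k / (k + 1)) j
            / (Ring.choose ((n : ℝ) - k / (k + 1)) n * (n.choose j : ℝ))
          * ∑ l ∈ Finset.range (m + 1), (m.choose l : ℝ) * (-1) ^ l
              * Ring.choose ((n : ℝ) - k * (2 + l) / (k + 1)) (n - j)) ∧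
    -- `j` fixed
    (∀ j : ℕ, 1 ≤ j →
      ∃ (ν : Measure ℝ) (_ : IsProbabilityMeasure ν),
        TendstoInDistribution
          (fun (n : ℕ) (T : OrderedIncreasingKTree k n) =>
            (n : ℝ) ^ (-((k : ℝ) / (k + 1))) * (T.outDegree j : ℝ))
          atTop (id : ℝ → ℝ) (fun n => randomKTree k n) ν ∧
        (∀ s : ℕ, Integrable (fun x : ℝ => x ^ s) ν ∧
          ∫ x, x ^ s ∂ν =
            (s.factorial : ℝ) * Real.Gamma ((j : ℝ) + 1 / (k + 1))
              / Real.Gamma ((j : ℝ) + 1 + k * ((s : ℝ) - 1) / (k + 1))) ∧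
        (∀ ν' : Measure ℝ, IsProbabilityMeasure ν' →
          (∀ s : ℕ, Integrable (fun x : ℝ => x ^ s) ν' ∧ ∫ x, x ^ s ∂ν' = ∫ x, x ^ s ∂ν) →
          ν' = ν)) ∧
    -- `j → ∞`, `j = o(n)`
    (∀ j : ℕ → ℕ, Tendsto j atTop atTop →
      (fun n : ℕ => (j n : ℝ)) =o[atTop] (fun n : ℕ => (n : ℝ)) →
      TendstoInDistribution
        (fun (n : ℕ) (T : OrderedIncreasingKTree k n) =>
          ((j n : ℝ) / n) ^ ((k : ℝ) / (k + 1)) * (T.outDegree (j n) : ℝ))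
        atTop (id : ℝ → ℝ) (fun n => randomKTree k n) (expMeasure 1)) ∧
    (∀ s : ℕ, Integrable (fun x : ℝ => x ^ s) (expMeasure 1) ∧
      ∫ x, x ^ s ∂(expMeasure 1) = (s.factorial : ℝ)) ∧
    -- `j ∼ ρ n`, `0 < ρ < 1`
    (∀ (ρ : ℝ) (j : ℕ → ℕ), 0 < ρ → ρ < 1 → Tendsto j atTop atTop →
      (fun n : ℕ => (j n : ℝ)) ~[atTop] (fun n : ℕ => ρ * (n : ℝ)) →
      ∃ p : unitInterval, (p : ℝ) = ρ ^ ((k : ℝ) / (k + 1)) ∧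
        TendstoInDistribution
          (fun (n : ℕ) (T : OrderedIncreasingKTree k n) => T.outDegree (j n))
          atTop (id : ℕ → ℕ) (fun n => randomKTree k n) (geometricMeasure p) ∧
        (∀ m : ℕ, (geometricMeasure p).real {m} =
          ρ ^ ((k : ℝ) / (k + 1)) * (1 - ρ ^ ((k : ℝ) / (k + 1))) ^ m)) ∧
    -- `j → ∞`, `n - j = o(n)`
    (∀ j : ℕ → ℕ, Tendsto j atTop atTop → (∀ᶠ n in atTop, j n ≤ n) →
      (fun n : ℕ => (n : ℝ) - (j n : ℝ)) =o[atTop] (fun n : ℕ => (n : ℝ)) →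
      Tendsto (fun n : ℕ => (randomKTree k n).real {T | T.outDegree (j n) = 0})
        atTop (𝓝 1)) := by
  have hk0 : (0 : ℝ) < k := Nat.cast_pos.2 hk
  have ha : (0 : ℝ) < (k : ℝ) / (k + 1) := by positivity
  refine ⟨fun n j m hj hjn =>
      OrderedIncreasingKTree.randomKTree_real_outDegree_eq_choose hk hj hjn m,
    fun j hj => ?_, fun j hj hjn => ?_, expMeasure_one_moments, fun ρ j hρ hρ1 hj hjn => ?_,
    fun j hj hjn hsub => ?_⟩
  · obtain ⟨ν, hν, h1, h2⟩ := OrderedIncreasingKTree.exists_tendstoInDistribution _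
      (OrderedIncreasingKTree.tendsto_integral_pow_of_fixed hk hj)
      (factorial_mul_Gamma_div_Gamma_le hj)
    refine ⟨ν, hν, h1, h2, fun ν' hν' h => ?_⟩
    exact Measure.eq_of_moments (fun s => (h2 s).1)
      (fun s => (h2 s).2.trans_le (factorial_mul_Gamma_div_Gamma_le hj s)) (fun s => (h s).1)
      fun s => (h s).2
  · obtain ⟨ν, hν, h1, h2⟩ := OrderedIncreasingKTree.exists_tendstoInDistribution _
      (OrderedIncreasingKTree.tendsto_integral_pow_of_isLittleO hk hj hjn)
      (C := 1) fun s => (one_mul _).ge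
    have heq : ν = expMeasure 1 := Measure.eq_of_moments (C := 1)
      (fun s => (expMeasure_one_moments s).1)
      (fun s => by rw [(expMeasure_one_moments s).2, one_mul]) (fun s => (h2 s).1)
      fun s => (h2 s).2.trans (expMeasure_one_moments s).2.symm
    subst heq
    exact h1
  · have hρa : 0 < ρ ^ ((k : ℝ) / (k + 1)) := Real.rpow_pos_of_pos hρ _
    have hlim : Tendsto (fun n => (j n : ℝ) / n) atTop (𝓝 ρ) := by
      have h1 := (isEquivalent_iff_tendsto_one ?_).1 hjn
      · have h2 := h1.mul_const ρ
        rw [one_mul] at h2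
        refine h2.congr fun n => ?_
        simp only [Pi.div_apply]
        field_simp
      · filter_upwards [eventually_gt_atTop 0] with n hn
        exact (mul_pos hρ (Nat.cast_pos.2 hn)).ne'
    have hle : ∀ᶠ n in atTop, j n ≤ n := by
      filter_upwards [hlim.eventually_lt_const hρ1, eventually_gt_atTop 0] with n h1 h2
      rw [div_lt_one (Nat.cast_pos.2 h2)] at h1
      exact (Nat.cast_lt.1 h1).le
    set p : unitInterval := ⟨ρ ^ ((k : ℝ) / (k + 1)), hρa.le, Real.rpow_le_one hρ.le hρ1.le ha.le⟩
    have hp : p ≠ 0 := fun h => hρa.ne' (congrArg Subtype.val h)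
    refine ⟨p, rfl, OrderedIncreasingKTree.tendstoInDistribution_geometric hp
      (OrderedIncreasingKTree.tendsto_randomKTree_real_outDegree_eq hk hρ hj hle hlim),
      fun m => ?_⟩
    rw [geometricMeasure_real_singleton hp, mul_comm]
  · have hlim : Tendsto (fun n => (j n : ℝ) / n) atTop (𝓝 1) := by
      have h1 := hsub.tendsto_div_nhds_zero.const_sub 1
      rw [sub_zero] at h1
      refine h1.congr' ?_
      filter_upwards [eventually_gt_atTop 0] with n hn
      have : (n : ℝ) ≠ 0 := Nat.cast_ne_zero.2 hn.ne'
      field_simp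
      ring
    simpa using OrderedIncreasingKTree.tendsto_randomKTree_real_outDegree_eq hk one_pos hj hjn
      hlim 0
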